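/- **Setting.** Let $f:\mathbb R^n\to\mathbb R$, $A_{eq}:\mathbb R^n\to\mathbb R^{m\times n}$, $A_{ineq}:\mathbb R^n\to\mathbb R^{p\times n}$, $d_{eq}\in\mathbb R^m$, $d_{ineq}\in\mathbb R^p$, and suppose that $f$, $g_{eq}:=A_{eq}\nabla f+d_{eq}$ and $g_{ineq}:=A_{ineq}\nabla f+d_{ineq}$ are differentiable. Consider the problem of minimising $f(z)$ subject to $g_{eq}(z)=0$, $g_{ineq}(z)\le 0$. Let $\mathcal G_{ineq}=\{z: g_{ineq}(z)\le 0\}$, $\Gamma=\{z\in\mathcal G_{ineq}: g_{eq}(z)=0\}$, $\mathcal I(z)=\{i: g_{ineq,i}(z)=0\}$ and $\mathcal S=\{s\subseteq\{1,\dots,p\}: s\subseteq\mathcal I(z)\text{ for some }z\in\mathbb R^n\}$. A point $z$ satisfies the KKT conditions if $z\in\Gamma$ and there are $\lambda\in\mathbb R^m$, $\nu\in\mathbb R^p$ with $\nu\ge 0$, $\nu_i\,g_{ineq,i}(z)=0$ for all $i$, and $\nabla f(z)+\frac{\partial^\top g_{eq}}{\partial z}(z)\lambda+\frac{\partial^\top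 g_{ineq}}{\partial z}(z)\nu=0$. For $\mathcal A\in\mathcal S$ with $a$ elements let $E_{\mathcal A}\in\mathbb R^{a\times p}$ have the rows $e_i^\top$, $i\in\mathcal A$, and put $A_{\mathcal A}=\begin{bmatrix}A_{eq}\\E_{\mathcal A}A_{ineq}\end{bmatrix}$, $d_{\mathcal A}=\begin{bmatrix}d_{eq}\\E_{\mathcal A}d_{ineq}\end{bmatrix}$, $g_{\mathcal A}=A_{\mathcal A}\nabla f+d_{\mathcal A}$, $B_{\mathcal A}=\frac{\partial g_{\mathcal A}}{\partial z}A_{\mathcal A}^\top$. Assume that for each $\mathcal A\in\mathcal S$ there are constants $\beta^1_{\mathcal A},\beta^2_{\mathcal A}>0$ such that for all $z\in\mathcal G_{ineq}$ the matrix $B_{\mathcal A}(z)$ is invertible and $\frac12[B_{\mathcal A}+B_{\mathcal A}^\top]\ge\frac12\beta^1_{\mathcal A}B_{\mathcal A}B_{\mathcal A}^\top\ge\beta^2_{\mathcal A}I$. Let $G^\perp_{\mathcal A}(z)\in\mathbb R^{(n-m-a)\times n}$ have full rank and satisfy $G^\perp_{\mathcal A}(z)\frac{\partial^\top g_{\mathcal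 A}}{\partial z}(z)=0$ for $z\in\mathcal G_{ineq}$. With $\kappa_1,\kappa_2,\delta T>0$ the subsystem $\mathcal A$ is $$\dot z=h_{\mathcal A}(z)=-\left[\kappa_1A_{\mathcal A}^\top B_{\mathcal A}^{-1}A_{\mathcal A}+\kappa_2G_{\mathcal A}^{\perp\top}G^\perp_{\mathcal A}\right]\nabla f-\kappa_1A_{\mathcal A}^\top B_{\mathcal A}^{-1}d_{\mathcal A}.$$ **Switching law.** At time $t$, with point $z$, active set $\sigma$ and time $T_s$ of the last removal, every $i\in\mathcal I(z)\setminus\sigma$ with $\frac{\partial g_{ineq,i}}{\partial z}(z)h_\sigma(z)\ge 0$ is added to $\sigma$. An index $k\in\sigma$ qualifies for removal if $\frac{\partial g_{ineq,k}}{\partial z}(z)h_{\sigma\setminus\{k\}}(z)<0$ and $t>T_s+\delta T$; if some index qualifies, then one such index is removed and $T_s$ is set to $t$. The result is $\sigma(t^+)$. A trajectory is a pair $(z,\sigma)$ on $[0,\infty)$ with $z(0)\in\mathcal G_{ineq}$, $\sigma$ piecewise constant and left-continuous with values in $\mathcal S$, $z$ a Carathéodory solution of $\dot z=h_\sigma(z)$,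 and $\sigma(t^+)$ given by the law for all $t\ge0$. Let $\mathcal T^\star$ be any family of complete trajectories that contains all trajectories with $\sigma(0)=\mathcal I(z(0))$, and whose members satisfy $\sigma(0)\subseteq\mathcal I(z(0))$ and obey the law, except that a removal may come later than at the first possible moment, as long as no removal condition is ignored forever. A nonempty $M\subseteq\mathbb R^n\times\mathcal S$ is weakly invariant if for every $(\xi,\gamma)\in M$ some $(z,\sigma)\in\mathcal T^\star$ has $z(0)=\xi$, $\sigma(0)=\gamma$ and $(z(t),\sigma(t))\in M$ for all $t\ge 0$. For a sublevel set $\mathcal F0$ of $f$ let $$\Omega=\mathcal F0\cap\{z\in\Gamma:\ \exists \mathcal A\in\mathcal S\text{ with }\mathcal A\subseteq\mathcal I(z)\text{ and }G^\perp_{\mathcal A}(z)\nabla f(z)=0\}.$$ **Proposition.** 1. For every sublevel set $\mathcal F0$, each point $z$ of each pair $(z,\gamma)$ in the largest weakly invariant set contained in $\Omega\times\mathcal S$ satisfies the KKT conditions. 2. Let $\bar z\in\mathcal G_{ineq}$ be an equilibrium of the subsystem $\mathcal A\in\mathcal S$, and let $\bar\lambda\in\mathbb R^m$, $\bar\nu\in\mathbb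 R^a$ satisfy $\nabla f(\bar z)+\frac{\partial^\top g_{eq}}{\partial z}(\bar z)\bar\lambda+\frac{\partial^\top g_{ineq}}{\partial z}(\bar z)E_{\mathcal A}^\top\bar\nu=0$. If $\bar\nu_k<0$ for some $k\in\mathcal A$, then $g_{ineq,k}$ and $f$ have strictly negative derivatives at $\bar z$ along $h_{\mathcal A\setminus\{k\}}$. At $(\bar z,\mathcal A)$, as soon as $t>T_s+\delta T$, the removal of $k$ is a possible result of the law (giving $\mathcal I(\bar z)\setminus\{k\}$), and every result is $\mathcal I(\bar z)\setminus\{j\}$ for some $j\in\mathcal A$ with $\bar\nu_j<0$, with $f$ having a strictly negative derivative at $\bar z$ along the new subsystem. No trajectory in $\mathcal T^\star$ stays at $\bar z$ for all time, and $\bar z$ is not a point of the largest weakly invariant set contained in $\Omega\times\mathcal S$. 3. With $\bar z,\mathcal A,\bar\lambda,\bar\nu$ as in 2, if instead $\bar\nu\ge0$, then $\bar z$ satisfies the KKT conditions and is an equilibrium of the subsystem $\mathcal I(\bar z)$. At $\bar z$ the law maps the active set $\mathcal A$ to $\mathcal I(\bar z)$, and $\mathcal I(\bar z)$ to itself, for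 all values of $t$ and $T_s$ and without removal. The set $\{(\bar z,\mathcal I(\bar z))\}$ is weakly invariant. If $h_{\mathcal I(\bar z)}$ is Lipschitz in a neighbourhood of $\bar z$, then every trajectory in $\mathcal T^\star$ that starts at $(\bar z,\mathcal I(\bar z))$ stays there. -/

import Mathlib

open Filter Topology Matrix MeasureTheory

noncomputable section

/-- The gradient of `u` at `z`, as the vector of partial derivatives. -/
def gradVec {n : ℕ} (u : (Fin n → ℝ) → ℝ) (z : Fin n → ℝ) : Fin n → ℝ :=
  fun j => fderiv ℝ u z (Pi.single j 1)

/-- Data of the optimisation problem `min f(z)` subject to `Aeq(z) ∇f(z) + deq = 0` and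
`Aineq(z) ∇f(z) + dineq ≤ 0`, with the parameters of the optimisation dynamics: the gains
`κ₁, κ₂`, the minimum time `δT` between removals, and, for every set `A` of inequality indices,
the matrix function `G_A^⊥`. -/
structure SwitchedProblem (n m p : ℕ) where
  f : (Fin n → ℝ) → ℝ
  Aeq : (Fin n → ℝ) → Matrix (Fin m) (Fin n) ℝ
  Aineq : (Fin n → ℝ) → Matrix (Fin p) (Fin n) ℝ
  deq : Fin m → ℝ
  dineq : Fin p → ℝ
  κ₁ : ℝ
  κ₂ : ℝ
  δT : ℝ
  Gperp : (A : Finset (Fin p)) → (Fin n → ℝ) → Matrix (Fin (n - m - A.card)) (Fin n) ℝ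

namespace SwitchedProblem

variable {n m p : ℕ} (P : SwitchedProblem n m p)

/-- The gradient of the objective function. -/
def gradf (z : Fin n → ℝ) : Fin n → ℝ := gradVec P.f z

def geq (z : Fin n → ℝ) : Fin m → ℝ := P.Aeq z *ᵥ P.gradf z + P.deq

def gineq (z : Fin n → ℝ) : Fin p → ℝ := P.Aineq z *ᵥ P.gradf z + P.dineq

/-- The Jacobian matrix of the equality constraints. -/
def Jeq (z : Fin n → ℝ) : Matrix (Fin m) (Fin n) ℝ :=
  Matrix.of fun i => gradVec (fun w => P.geq w i) z

/-- The Jacobian matrix of the inequality constraints. -/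
def Jineq (z : Fin n → ℝ) : Matrix (Fin p) (Fin n) ℝ :=
  Matrix.of fun i => gradVec (fun w => P.gineq w i) z

/-- The set on which the inequality constraints hold. -/
def Gineq : Set (Fin n → ℝ) := {z | ∀ i, P.gineq z i ≤ 0}

/-- The set on which the equality constraints hold. -/
def Geq : Set (Fin n → ℝ) := {z | P.geq z = 0}

/-- The feasible set. -/
def Gam : Set (Fin n → ℝ) := P.Gineq ∩ P.Geq

/-- The Karush-Kuhn-Tucker conditions at `z`. -/
def KKT (z : Fin n → ℝ) : Prop :=
  ∃ (lam : Fin m → ℝ) (nu : Fin p → ℝ),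
    P.gradf z + (P.Jeq z)ᵀ *ᵥ lam + (P.Jineq z)ᵀ *ᵥ nu = 0 ∧
    P.geq z = 0 ∧ (∀ i, P.gineq z i ≤ 0) ∧ (∀ i, 0 ≤ nu i) ∧ (∀ i, nu i * P.gineq z i = 0)

open Classical in
/-- `𝓘(z)`: the indices of the inequality constraints that hold with equality at `z`. -/
def idx (z : Fin n → ℝ) : Finset (Fin p) := Finset.univ.filter fun i => P.gineq z i = 0

/-- `𝓢`: the sets of inequality constraints that can hold with equality simultaneously. -/
def indexSets : Set (Finset (Fin p)) := {s | ∃ z : Fin n → ℝ, s ⊆ P.idx z}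

/-- `E_A v`: the entries of `v` with index in `A`. -/
def restr (A : Finset (Fin p)) (v : Fin p → ℝ) : {i // i ∈ A} → ℝ := fun i => v i

/-- `A_A(z)`: the rows of `Aeq(z)`, followed by those rows of `Aineq(z)` with index in `A`. -/
def AA (A : Finset (Fin p)) (z : Fin n → ℝ) : Matrix (Fin m ⊕ {i // i ∈ A}) (Fin n) ℝ :=
  Matrix.of (Sum.elim (fun i => P.Aeq z i) (fun i => P.Aineq z i.1))

/-- `d_A`. -/
def dA (A : Finset (Fin p)) : Fin m ⊕ {i // i ∈ A} → ℝ := Sum.elim P.deq (restr A P.dineq)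

/-- `∂g_A/∂z`. -/
def JA (A : Finset (Fin p)) (z : Fin n → ℝ) : Matrix (Fin m ⊕ {i // i ∈ A}) (Fin n) ℝ :=
  Matrix.of (Sum.elim (fun i => P.Jeq z i) (fun i => P.Jineq z i.1))

/-- `B_A(z) = (∂g_A/∂z) A_Aᵀ`. -/
def BA (A : Finset (Fin p)) (z : Fin n → ℝ) :
    Matrix (Fin m ⊕ {i // i ∈ A}) (Fin m ⊕ {i // i ∈ A}) ℝ :=
  P.JA A z * (P.AA A z)ᵀ

/-- The vector field `h_A` of the subsystem with active set `A`. -/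
def h (A : Finset (Fin p)) (z : Fin n → ℝ) : Fin n → ℝ :=
  -((P.κ₁ • ((P.AA A z)ᵀ * (P.BA A z)⁻¹ * P.AA A z)
      + P.κ₂ • ((P.Gperp A z)ᵀ * P.Gperp A z)) *ᵥ P.gradf z)
    - P.κ₁ • (((P.AA A z)ᵀ * (P.BA A z)⁻¹) *ᵥ P.dA A)

/-- The standing assumptions: differentiable data, positive tuning parameters, the technical
assumption on `B_A` on the set `Gineq`, and the choice of `G_A^⊥` as a full rank left annihilator
of the transposed Jacobian of the active constraints. -/
structure Admissible : Prop where
  diff_f : Differentiable ℝ P.f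
  diff_geq : Differentiable ℝ P.geq
  diff_gineq : Differentiable ℝ P.gineq
  κ₁_pos : 0 < P.κ₁
  κ₂_pos : 0 < P.κ₂
  δT_pos : 0 < P.δT
  B_pos : ∀ A ∈ P.indexSets, ∃ β₁ β₂ : ℝ, 0 < β₁ ∧ 0 < β₂ ∧ ∀ z ∈ P.Gineq,
    IsUnit (P.BA A z) ∧
    ((1 / 2 : ℝ) • (P.BA A z + (P.BA A z)ᵀ)
      - (1 / 2 * β₁) • (P.BA A z * (P.BA A z)ᵀ)).PosSemidef ∧
    ((1 / 2 * β₁) • (P.BA A z * (P.BA A z)ᵀ)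
      - β₂ • (1 : Matrix (Fin m ⊕ {i // i ∈ A}) (Fin m ⊕ {i // i ∈ A}) ℝ)).PosSemidef
  annihilator : ∀ A ∈ P.indexSets, ∀ z ∈ P.Gineq,
    P.Gperp A z * (P.JA A z)ᵀ = 0 ∧ (P.Gperp A z).rank = n - m - A.card

/-! The switching law. Its inputs are the time `t`, the point `z`, the active set `s` and the time
`τ` of the last removal; its outputs are the updated active set `s'` and the updated time `τ'`. -/

open Classical in
/-- The indices that the switching law adds: constraints outside the active set that hold with
equality and do not decrease along the current subsystem. -/
def addIdx (z : Fin n → ℝ) (s : Finset (Fin p)) : Finset (Fin p) :=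
  (P.idx z \ s).filter fun i => 0 ≤ P.Jineq z i ⬝ᵥ P.h s z

/-- The condition under which the switching law removes the index `k`. -/
def Removable (t : ℝ) (z : Fin n → ℝ) (s : Finset (Fin p)) (τ : ℝ) (k : Fin p) : Prop :=
  k ∈ s ∧ P.Jineq z k ⬝ᵥ P.h (s \ {k}) z < 0 ∧ τ + P.δT < t

/-- One execution of the switching law: all indices that qualify are added. If some index
qualifies for removal, then exactly one such index (the first one that the loop meets, in an order
that is not prescribed) is removed, because the removal sets the clock to `t`. -/
def LawStep (t : ℝ) (z : Fin n → ℝ) (s : Finset (Fin p)) (τ : ℝ)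
    (s' : Finset (Fin p)) (τ' : ℝ) : Prop :=
  ((∀ k, ¬ P.Removable t z s τ k) ∧ s' = s ∪ P.addIdx z s ∧ τ' = τ) ∨
  (∃ k, P.Removable t z s τ k ∧ s' = (s ∪ P.addIdx z s) \ {k} ∧ τ' = t)

/-- The same, except that a removal is permitted, but not enforced, when its condition holds. -/
def DelayedStep (t : ℝ) (z : Fin n → ℝ) (s : Finset (Fin p)) (τ : ℝ)
    (s' : Finset (Fin p)) (τ' : ℝ) : Prop :=
  (s' = s ∪ P.addIdx z s ∧ τ' = τ) ∨
  (∃ k, P.Removable t z s τ k ∧ s' = (s ∪ P.addIdx z s) \ {k} ∧ τ' = t)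

/-- `(z, σ)` is a complete (defined for all `t ≥ 0`) Carathéodory solution of `ż = h_σ(z)` with
`z(0) ∈ Gineq`, where `σ` is piecewise constant with values in `𝓢`, `T t` is the time of the last
removal before `t`, and at every `t ≥ 0` the values `σ(t⁺)`, `T(t⁺)` result from `σ(t)`, `T(t)` by
the update rule `step`. -/
structure IsRun
    (step : ℝ → (Fin n → ℝ) → Finset (Fin p) → ℝ → Finset (Fin p) → ℝ → Prop)
    (z : ℝ → Fin n → ℝ) (σ : ℝ → Finset (Fin p)) (T : ℝ → ℝ) : Prop where
  init : z 0 ∈ P.Gineq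
  clock : T 0 ≤ 0
  mem : ∀ t, 0 ≤ t → σ t ∈ P.indexSets
  integrable : ∀ t, 0 ≤ t → IntervalIntegrable (fun r => P.h (σ r) (z r)) volume 0 t
  solution : ∀ t, 0 ≤ t → z t = z 0 + ∫ r in (0 : ℝ)..t, P.h (σ r) (z r)
  left : ∀ t, 0 < t → ∀ᶠ r in 𝓝[<] t, σ r = σ t ∧ T r = T t
  update : ∀ t, 0 ≤ t → ∃ s' τ', step t (z t) (σ t) (T t) s' τ' ∧
    ∀ᶠ r in 𝓝[>] t, σ r = s' ∧ T r = τ'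

/-- The complete solutions of the switched system: the switching law is executed at every time,
and the active set is initialised as `σ(0) = 𝓘(z(0))`. -/
def promptFamily : Set ((ℝ → Fin n → ℝ) × (ℝ → Finset (Fin p))) :=
  {x | ∃ T, P.IsRun P.LawStep x.1 x.2 T ∧ x.2 0 = P.idx (x.1 0)}

/-- A larger family. First, a trajectory may start at a later stage of a solution,
`σ(0) ⊆ 𝓘(z(0))`. Secondly, a removal may come later than at the first possible moment, as long as
no removal condition is ignored forever. (The conditions for a removal are strict inequalities. If
they start to hold along a trajectory, there may be no first instant at which they hold, and then
no trajectory executes the removal without delay.) -/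
def delayedFamily : Set ((ℝ → Fin n → ℝ) × (ℝ → Finset (Fin p))) :=
  {x | ∃ T, P.IsRun P.DelayedStep x.1 x.2 T ∧ x.2 0 ⊆ P.idx (x.1 0) ∧
    ∀ k, ∃ᶠ t in atTop, ¬ P.Removable t (x.1 t) (x.2 t) (T t) k}

/-- Weak invariance of a set of pairs (point, active set) with respect to a family of complete
trajectories. -/
def WeaklyInvariant (F : Set ((ℝ → Fin n → ℝ) × (ℝ → Finset (Fin p))))
    (M : Set ((Fin n → ℝ) × Finset (Fin p))) : Prop :=
  M.Nonempty ∧ (∀ x ∈ M, x.2 ∈ P.indexSets) ∧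
  ∀ x ∈ M, ∃ y ∈ F, y.1 0 = x.1 ∧ y.2 0 = x.2 ∧ ∀ t : ℝ, 0 ≤ t → (y.1 t, y.2 t) ∈ M

/-- The largest weakly invariant set contained in `Om`: the union of all of them. -/
def largestInvariant (F : Set ((ℝ → Fin n → ℝ) × (ℝ → Finset (Fin p))))
    (Om : Set (Fin n → ℝ)) : Set ((Fin n → ℝ) × Finset (Fin p)) :=
  ⋃₀ {M | P.WeaklyInvariant F M ∧ ∀ x ∈ M, x.1 ∈ Om}

/-- `Ω`: the feasible points of the sublevel set `{f ≤ c}` at which `G_A^⊥ ∇f = 0` for some set `A`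
of constraints that are active there. -/
def Omega (c : ℝ) : Set (Fin n → ℝ) :=
  {z | P.f z ≤ c} ∩
    {z | z ∈ P.Gam ∧ ∃ A ∈ P.indexSets, A ⊆ P.idx z ∧ P.Gperp A z *ᵥ P.gradf z = 0}

/-- `lam` and `nu` are Lagrange multipliers of the subsystem with active set `A` at `z`:
`∇f + (∂g_eq/∂z)ᵀ lam + (∂g_ineq/∂z)ᵀ E_Aᵀ nu = 0`. -/
def IsMultiplier (A : Finset (Fin p)) (z : Fin n → ℝ)
    (lam : Fin m → ℝ) (nu : {i // i ∈ A} → ℝ) : Prop :=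
  P.gradf z + (P.JA A z)ᵀ *ᵥ (Sum.elim lam nu) = 0

variable {P}

/-- The union of all weakly invariant subsets is weakly invariant, unless it is empty. -/
theorem weaklyInvariant_largestInvariant
    {F : Set ((ℝ → Fin n → ℝ) × (ℝ → Finset (Fin p)))} {Om : Set (Fin n → ℝ)}
    (hne : (P.largestInvariant F Om).Nonempty) :
    P.WeaklyInvariant F (P.largestInvariant F Om) := by
  refine ⟨hne, ?_, ?_⟩
  · rintro x ⟨M, hM, hx⟩
    exact hM.1.2.1 x hx
  · rintro x ⟨M, hM, hx⟩
    obtain ⟨y, hy, h0, h1, h2⟩ := hM.1.2.2 x hx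
    exact ⟨y, hy, h0, h1, fun t ht => ⟨M, hM, h2 t ht⟩⟩

/-- Every solution that executes the switching law at every time belongs to the larger family. -/
theorem promptFamily_subset_delayedFamily (hδ : 0 < P.δT) :
    P.promptFamily ⊆ P.delayedFamily := by
  rintro x ⟨T, hrun, h0⟩
  refine ⟨T, ⟨hrun.init, hrun.clock, hrun.mem, hrun.integrable, hrun.solution, hrun.left, ?_⟩,
    h0.le, ?_⟩
  · intro t ht
    obtain ⟨s', τ', hs, hev⟩ := hrun.update t ht
    refine ⟨s', τ', ?_, hev⟩
    rcases hs with ⟨_, h1⟩ | h1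
    · exact Or.inl h1
    · exact Or.inr h1
  · intro k
    rw [frequently_atTop]
    intro a
    by_contra! hcon
    have ha : a ≤ max a 0 := le_max_left _ _
    have ha0 : (0 : ℝ) ≤ max a 0 := le_max_right _ _
    obtain ⟨s', τ', hs, hev⟩ := hrun.update _ ha0
    rcases hs with ⟨h1, _⟩ | ⟨j, _, _, hτ⟩
    · exact h1 k (hcon _ ha)
    · have h2 : ∀ᶠ r in 𝓝[>] (max a 0), r < max a 0 + P.δT ∧ max a 0 < r := by
        filter_upwards [self_mem_nhdsWithin,
          mem_nhdsWithin_of_mem_nhds (Iio_mem_nhds (show max a 0 < max a 0 + P.δT by linarith))]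
          with r hr1 hr2 using ⟨hr2, hr1⟩
      obtain ⟨r, ⟨_, hr⟩, hr2, hr3⟩ := (hev.and h2).exists
      have := (hcon r (by linarith)).2.2
      rw [hr, hτ] at this
      linarith

end SwitchedProblem

end

/-!
An equilibrium of the subsystem `A` is a feasible point with `A ⊆ 𝓘(z)` at which `G_A^⊥ ∇f = 0`,
that is, at which `∇f` is a combination of the constraint gradients. Without the constraint `k` this
becomes `G^⊥ ∇f = -ν_k G^⊥ ∇g_k` with `G^⊥ ∇g_k ≠ 0`, so `f` strictly decreases if `ν_k ≠ 0`, and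
`g_k` has a derivative with the sign of `ν_k`.

Consider a trajectory in `Ω`, on an interval where the active set `σ` is constant. For `i ∈ σ`,
`d/dt g_i = -κ₁ g_i ≥ 0` and `g_i ≤ 0`, so an active `g_i` stays active. At almost every time
each active `g_i` is at a local maximum and has derivative zero, so the law would have added it to
`σ`. Hence `σ = 𝓘(z)`, whose field vanishes on `Ω`, and the trajectory rests. At a resting point
`σ = 𝓘(z)` and the removal clock is frozen. As no removal may be ignored forever, the multipliers
are nonnegative, which is the KKT condition.
-/

theorem forall_mem_Icc_of_nhdsGT {α : Type*} [ConditionallyCompleteLinearOrder α]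
    [TopologicalSpace α] [OrderTopology α] [DenselyOrdered α] {Q : α → Prop} {a b : α} (ha : Q a)
    (hright : ∀ t ∈ Set.Ico a b, Q t → ∀ᶠ s in 𝓝[>] t, Q s)
    (hleft : ∀ t ∈ Set.Ioc a b, (∀ s ∈ Set.Ico a t, Q s) → Q t) : ∀ t ∈ Set.Icc a b, Q t := by
  suffices Set.Icc a b ⊆ {t | ∀ r ∈ Set.Icc a t, Q r} from fun t ht => this ht t ⟨ht.1, le_rfl⟩
  refine IsClosed.Icc_subset_of_forall_mem_nhdsWithin ?_ ?_ ?_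
  · refine isClosed_of_closure_subset fun t ht => ?_
    have htab : t ∈ Set.Icc a b :=
      closure_minimal Set.inter_subset_right isClosed_Icc ht
    have hbelow : ∀ r ∈ Set.Ico a t, Q r := by
      rintro r ⟨har, hrt⟩
      obtain ⟨s, hrs, hs, -⟩ := mem_closure_iff.1 ht _ isOpen_Ioi hrt
      exact hs r ⟨har, le_of_lt hrs⟩
    refine ⟨fun r hr => ?_, htab⟩
    rcases hr.2.lt_or_eq with hrt | rfl
    · exact hbelow r ⟨hr.1, hrt⟩
    · rcases hr.1.eq_or_lt with rfl | har
      · exact ha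
      · exact hleft r ⟨har, htab.2⟩ hbelow
  · rintro r ⟨har, hra⟩
    exact le_antisymm hra har ▸ ha
  · rintro t ⟨ht, hat, htb⟩
    obtain ⟨u, htu, hu⟩ := (mem_nhdsGT_iff_exists_Ioo_subset' htb).1
      (hright t ⟨hat, htb⟩ (ht t ⟨hat, le_rfl⟩))
    filter_upwards [Ioo_mem_nhdsGT htu] with s hs r hr
    rcases le_or_gt r t with hrt | htr
    · exact ht r ⟨hr.1, hrt⟩
    · exact hu ⟨htr, hr.2.trans_lt hs.2⟩

/- With `g` lower semicontinuous and infinite on `N`, take `ν` with density `g`. -/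
theorem exists_measure_forall_eventually_smul_le {α : Type*} [TopologicalSpace α]
    [MeasurableSpace α] [BorelSpace α] (μ : Measure α) [μ.WeaklyRegular] {N : Set α}
    (hN : μ N = 0) {ε : ENNReal} (hε : ε ≠ 0) :
    ∃ ν : Measure α, ν Set.univ ≤ ε ∧
      ∀ x ∈ N, ∀ k : NNReal, ∀ᶠ s in (𝓝 x).smallSets, (k : ENNReal) * μ s ≤ ν s := by
  have hmeas : MeasurableSet (toMeasurable μ N) := measurableSet_toMeasurable μ N
  obtain ⟨g, hfg, hg, hgε⟩ := exists_le_lowerSemicontinuous_lintegral_ge μ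
    ((toMeasurable μ N).indicator fun _ => ⊤) (measurable_const.indicator hmeas) hε
  rw [lintegral_indicator_const hmeas, measure_toMeasurable, hN, mul_zero, zero_add] at hgε
  refine ⟨μ.withDensity g, by rwa [withDensity_apply _ .univ, Measure.restrict_univ], ?_⟩
  intro x hx k
  have hgx : g x = ⊤ := top_unique <| by
    simpa [Set.indicator_of_mem (subset_toMeasurable μ N hx)] using hfg x
  filter_upwards [eventually_smallSets_forall.2 (hg x k (by simp [hgx]))] with s hs
  calc (k : ENNReal) * μ s = ∫⁻ _ in s, k ∂μ := (setLIntegral_const s _).symm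
    _ ≤ ∫⁻ y in s, g y ∂μ := setLIntegral_mono hg.measurable fun y hy => (hs y hy).le
    _ ≤ μ.withDensity g s := withDensity_apply_le g s

theorem le_add_measureReal_Ioc_of_forall_eventually_nhdsGT {u : ℝ → ℝ} {a b : ℝ} (hab : a ≤ b)
    (hu : ContinuousOn u (Set.Icc a b)) (ν : Measure ℝ) [IsLocallyFiniteMeasure ν]
    (h : ∀ t ∈ Set.Ico a b, ∀ᶠ s in 𝓝[>] t, u t ≤ u s + ν.real (Set.Ioc t s)) :
    u a ≤ u b + ν.real (Set.Ioc a b) := by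
  refine forall_mem_Icc_of_nhdsGT (Q := fun t => u a ≤ u t + ν.real (Set.Ioc a t)) (b := b)
    (by simp) ?_ ?_ b ⟨hab, le_rfl⟩
  · intro t ht hat
    filter_upwards [h t ht, self_mem_nhdsWithin] with s hs hts
    rw [← Set.Ioc_union_Ioc_eq_Ioc ht.1 (le_of_lt hts),
      measureReal_union (Set.Ioc_disjoint_Ioc_of_le le_rfl) measurableSet_Ioc
        measure_Ioc_lt_top.ne measure_Ioc_lt_top.ne]
    linarith
  · intro t ht hbelow
    have hut : Tendsto u (𝓝[<] t) (𝓝 (u t)) :=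
      (hu.mono (Set.Icc_subset_Icc_right ht.2)).continuousWithinAt ⟨ht.1.le, le_rfl⟩ |>.mono_left
        (nhdsWithin_le_of_mem
          (Filter.mem_of_superset (Ioo_mem_nhdsLT ht.1) Set.Ioo_subset_Icc_self))
    refine ge_of_tendsto (hut.add_const _) ?_
    filter_upwards [Ioo_mem_nhdsLT ht.1] with s hs
    have hmono : ν.real (Set.Ioc a s) ≤ ν.real (Set.Ioc a t) :=
      measureReal_mono (Set.Ioc_subset_Ioc_right hs.2.le) measure_Ioc_lt_top.ne
    linarith [hbelow s ⟨hs.1.le, hs.2⟩]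

theorem eventually_le_add_mul_sub_of_hasDerivWithinAt {u : ℝ → ℝ} {c t ε : ℝ}
    (hu : HasDerivWithinAt u c (Set.Ioi t) t) (hc : 0 ≤ c) (hε : 0 < ε) :
    ∀ᶠ s in 𝓝[>] t, u t ≤ u s + ε * (s - t) := by
  have hslope : ∀ᶠ s in 𝓝[>] t, -ε < slope u t s :=
    (hasDerivWithinAt_iff_tendsto_slope' (by simp)).1 hu |>.eventually (lt_mem_nhds (by linarith))
  filter_upwards [hslope, self_mem_nhdsWithin] with s hs hts
  rw [slope_def_field, lt_div_iff₀ (sub_pos.2 hts)] at hs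
  linarith

theorem le_of_ae_hasDerivWithinAt_nonneg {u : ℝ → ℝ} {a b : ℝ} (hab : a ≤ b)
    (hu : ContinuousOn u (Set.Icc a b)) (μ : Measure ℝ) [IsFiniteMeasure μ]
    (hderiv : ∀ᵐ t ∂μ, t ∈ Set.Ico a b → ∃ c, 0 ≤ c ∧ HasDerivWithinAt u c (Set.Ioi t) t)
    (hinc : ∀ t ∈ Set.Ico a b, ∃ k : NNReal,
      ∀ᶠ s in 𝓝[>] t, u t ≤ u s + k * μ.real (Set.Ioc t s)) :
    u a ≤ u b := by
  suffices H : ∀ ε : ℝ, 0 < ε → u a ≤ u b + ε * (b - a) + ε by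
    have hlim : Tendsto (fun ε : ℝ => u b + ε * (b - a) + ε) (𝓝[>] 0)
        (𝓝 (u b + 0 * (b - a) + 0)) :=
      (Continuous.tendsto (by fun_prop) 0).mono_left nhdsWithin_le_nhds
    simpa using ge_of_tendsto hlim (eventually_mem_nhdsWithin.mono fun ε hε => H ε hε)
  intro ε hε
  obtain ⟨ν, hνε, hν⟩ := exists_measure_forall_eventually_smul_le μ hderiv
    (ENNReal.ofReal_pos.2 hε).ne'
  have : IsFiniteMeasure ν := ⟨hνε.trans_lt ENNReal.ofReal_lt_top⟩
  have hνab : ν.real (Set.Ioc a b) ≤ ε :=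
    ENNReal.toReal_le_of_le_ofReal hε.le ((measure_mono (Set.subset_univ _)).trans hνε)
  have hstep : ∀ t ∈ Set.Ico a b,
      ∀ᶠ s in 𝓝[>] t, u t ≤ u s + ε * (s - t) + ν.real (Set.Ioc t s) := by
    intro t ht
    by_cases hgood : t ∈ Set.Ico a b → ∃ c, 0 ≤ c ∧ HasDerivWithinAt u c (Set.Ioi t) t
    · obtain ⟨c, hc, hd⟩ := hgood ht
      filter_upwards [eventually_le_add_mul_sub_of_hasDerivWithinAt hd hc hε] with s hs
      linarith [measureReal_nonneg (μ := ν) (s := Set.Ioc t s)]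
    · obtain ⟨k, hk⟩ := hinc t ht
      have hsmall : Tendsto (Set.Ioc t) (𝓝[>] t) (𝓝 t).smallSets :=
        tendsto_const_nhds.Ioc (tendsto_id.mono_left nhdsWithin_le_nhds)
      filter_upwards [hk, hsmall.eventually (hν t hgood k), self_mem_nhdsWithin] with s hs hks hts
      have hkν : k * μ.real (Set.Ioc t s) ≤ ν.real (Set.Ioc t s) := by
        simpa [Measure.real] using ENNReal.toReal_mono (measure_ne_top ν _) hks
      have hts' : 0 ≤ ε * (s - t) := mul_nonneg hε.le (sub_nonneg.2 (le_of_lt hts))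
      linarith
  have hub := le_add_measureReal_Ioc_of_forall_eventually_nhdsGT (u := fun t => u t + ε * t) hab
    (by fun_prop) ν fun t ht => (hstep t ht).mono fun s hs => by linarith
  linarith

/-- `z` is on `[0, ∞)` an absolutely continuous curve with velocity `v`. This is encoded by the
integral equation, which determines `v` only almost everywhere. -/
structure HasVelocity {E : Type*} [NormedAddCommGroup E] [NormedSpace ℝ E] (z v : ℝ → E) :
    Prop where
  intervalIntegrable_zero : ∀ t, 0 ≤ t → IntervalIntegrable v volume 0 t
  eq_add_integral : ∀ t, 0 ≤ t → z t = z 0 + ∫ r in (0 : ℝ)..t, v r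

namespace HasVelocity

variable {E : Type*} [NormedAddCommGroup E] [NormedSpace ℝ E] {z v : ℝ → E} {a b : ℝ}

theorem intervalIntegrable (hz : HasVelocity z v) (ha : 0 ≤ a) (hb : 0 ≤ b) :
    IntervalIntegrable v volume a b :=
  (hz.intervalIntegrable_zero a ha).symm.trans (hz.intervalIntegrable_zero b hb)

theorem sub_eq_integral (hz : HasVelocity z v) (ha : 0 ≤ a) (hb : 0 ≤ b) :
    z b - z a = ∫ r in a..b, v r := by
  rw [hz.eq_add_integral b hb, hz.eq_add_integral a ha, add_sub_add_left_eq_sub,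
    intervalIntegral.integral_interval_sub_left (hz.intervalIntegrable_zero b hb)
      (hz.intervalIntegrable_zero a ha)]

theorem continuousOn_Ici (hz : HasVelocity z v) : ContinuousOn z (Set.Ici 0) := by
  intro t ht
  have ht1 : (0 : ℝ) ≤ t + 1 := add_nonneg ht zero_le_one
  have hprim : ContinuousOn (fun s => z 0 + ∫ r in (0 : ℝ)..s, v r) (Set.Icc 0 (t + 1)) := by
    have := intervalIntegral.continuousOn_primitive_interval
      ((intervalIntegrable_iff' (by simp)).1 (hz.intervalIntegrable_zero (t + 1) ht1))
    exact continuousOn_const.add (Set.uIcc_of_le ht1 ▸ this)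
  refine (hprim.congr fun s hs => hz.eq_add_integral s hs.1) t ⟨ht, by linarith⟩
    |>.mono_of_mem_nhdsWithin ?_
  exact inter_mem_nhdsWithin _ (Iic_mem_nhds (lt_add_one t))

theorem continuousOn_Icc (hz : HasVelocity z v) (ha : 0 ≤ a) : ContinuousOn z (Set.Icc a b) :=
  hz.continuousOn_Ici.mono fun _ ht => ha.trans ht.1

theorem tendsto_nhdsGT (hz : HasVelocity z v) (ha : 0 ≤ a) : Tendsto z (𝓝[>] a) (𝓝 (z a)) :=
  (hz.continuousOn_Ici a ha).mono fun _ hs => ha.trans (le_of_lt hs)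

theorem tendsto_nhds (hz : HasVelocity z v) (ha : 0 < a) : Tendsto z (𝓝 a) (𝓝 (z a)) :=
  hz.continuousOn_Ici.continuousAt (Ici_mem_nhds ha)

theorem ae_hasDerivAt [CompleteSpace E] (hz : HasVelocity z v) :
    ∀ᵐ t, 0 < t → HasDerivAt z (v t) t := by
  have h : ∀ n : ℕ, ∀ᵐ t, t ∈ Set.uIcc (0 : ℝ) n →
      ∀ c ∈ Set.uIcc (0 : ℝ) n, HasDerivAt (fun x => ∫ r in c..x, v r) (v t) t := fun n =>
    (hz.intervalIntegrable_zero n n.cast_nonneg).ae_hasDerivAt_integral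
  filter_upwards [ae_all_iff.2 h] with t ht h0
  obtain ⟨n, hn⟩ := exists_nat_gt t
  have hprim : HasDerivAt (fun x => ∫ r in (0 : ℝ)..x, v r) (v t) t :=
    ht n (by rw [Set.uIcc_of_le n.cast_nonneg]; exact ⟨h0.le, hn.le⟩) 0 (by simp)
  refine (hprim.const_add (z 0)).congr_of_eventuallyEq ?_
  filter_upwards [Ioi_mem_nhds h0] with s hs using hz.eq_add_integral s (le_of_lt hs)

theorem norm_sub_le_measureReal_Ioc (hz : HasVelocity z v) (ha : 0 ≤ a) (hab : a ≤ b) {s : Set ℝ}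
    (hs : IntegrableOn v s) (hsub : Set.Ioc a b ⊆ s) :
    ‖z b - z a‖ ≤ ((volume.restrict s).withDensity fun r => ‖v r‖ₑ).real (Set.Ioc a b) := by
  rw [hz.sub_eq_integral ha (ha.trans hab), intervalIntegral.integral_of_le hab]
  refine (norm_integral_le_integral_norm _).trans_eq ?_
  rw [Measure.real, withDensity_apply _ measurableSet_Ioc,
    Measure.restrict_restrict measurableSet_Ioc, Set.inter_eq_left.2 hsub,
    integral_norm_eq_lintegral_enorm (hs.mono_set hsub).aestronglyMeasurable]

/- `g` need not be locally Lipschitz, so `g ∘ z` need not be absolutely continuous; its increments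
are controlled only pointwise, by the arc length measure of `z`. -/
theorem le_of_ae_fderiv_nonneg [CompleteSpace E] (hz : HasVelocity z v) {g : E → ℝ}
    (hg : Differentiable ℝ g) (ha : 0 ≤ a) (hab : a ≤ b)
    (h : ∀ᵐ t, t ∈ Set.Ioo a b → 0 ≤ fderiv ℝ g (z t) (v t)) : g (z a) ≤ g (z b) := by
  have hint : IntegrableOn v (Set.Ioc a b) :=
    (intervalIntegrable_iff_integrableOn_Ioc_of_le hab).1
      (hz.intervalIntegrable ha (ha.trans hab))
  set μ := (volume.restrict (Set.Ioc a b)).withDensity fun r => ‖v r‖ₑ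
  have : IsFiniteMeasure μ := ⟨by
    rw [withDensity_apply _ .univ, Measure.restrict_univ]
    exact hint.2⟩
  have hμ : μ ≪ volume :=
    (withDensity_absolutelyContinuous _ _).trans Measure.absolutelyContinuous_restrict
  refine le_of_ae_hasDerivWithinAt_nonneg (u := g ∘ z) hab
    (hg.continuous.comp_continuousOn (hz.continuousOn_Icc ha)) μ (hμ.ae_le ?_) fun t ht => ?_
  · filter_upwards [hz.ae_hasDerivAt, h, volume.ae_ne a] with t hzt ht hne htab
    have hat : a < t := htab.1.lt_of_ne' hne
    exact ⟨_, ht ⟨hat, htab.2⟩,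
      ((hg (z t)).hasFDerivAt.comp_hasDerivAt t (hzt (ha.trans_lt hat))).hasDerivWithinAt⟩
  · have ht0 : 0 ≤ t := ha.trans ht.1
    obtain ⟨C, hC⟩ := (hg (z t)).hasFDerivAt.isBigO_sub.bound
    refine ⟨C.toNNReal, ?_⟩
    filter_upwards [(hz.tendsto_nhdsGT ht0).eventually hC, Ioo_mem_nhdsGT ht.2] with s hs hts
    have hinc : |g (z s) - g (z t)| ≤ C.toNNReal * μ.real (Set.Ioc t s) := by
      calc |g (z s) - g (z t)| ≤ C * ‖z s - z t‖ := hs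
        _ ≤ C.toNNReal * ‖z s - z t‖ := by gcongr; exact Real.le_coe_toNNReal C
        _ ≤ C.toNNReal * μ.real (Set.Ioc t s) := by
          gcongr
          exact hz.norm_sub_le_measureReal_Ioc ht0 hts.1.le hint
            (Set.Ioc_subset_Ioc ht.1 hts.2.le)
    dsimp only [Function.comp_apply]
    linarith [neg_abs_le (g (z s) - g (z t))]

theorem eq_of_ae_norm_le_mul_norm_sub (hz : HasVelocity z v) (ha : 0 ≤ a) {K : ℝ}
    (h : ∀ᵐ r, r ∈ Set.Ioo a b → ‖v r‖ ≤ K * ‖z r - z a‖) : ∀ s ∈ Set.Icc a b, z s = z a := by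
  rcases lt_or_ge b a with hba | hab
  · simp [hba]
  set φ : ℝ → ℝ := fun s => ∫ r in a..s, ‖z r - z a‖
  have hdist : ContinuousOn (fun r => ‖z r - z a‖) (Set.Ici a) :=
    ((hz.continuousOn_Ici.mono (Set.Ici_subset_Ici.2 ha)).sub continuousOn_const).norm
  have hint : ∀ s, a ≤ s → IntervalIntegrable (fun r => ‖z r - z a‖) volume a s := fun s hs =>
    (hdist.mono Set.Icc_subset_Ici_self).intervalIntegrable_of_Icc hs
  have hφ : ∀ s, a ≤ s → HasDerivWithinAt φ ‖z s - z a‖ (Set.Ici s) s := fun s hs =>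
    intervalIntegral.integral_hasDerivWithinAt_right (hint s hs)
      ((hdist.mono fun r hr => hs.trans (le_of_lt hr)).stronglyMeasurableAtFilter_nhdsWithin
        measurableSet_Ioi s)
      ((hdist s hs).mono fun r hr => hs.trans (le_of_lt hr))
  have hbound : ∀ s ∈ Set.Icc a b, ‖z s - z a‖ ≤ K * φ s := by
    intro s hs
    rw [hz.sub_eq_integral ha (ha.trans hs.1), ← intervalIntegral.integral_const_mul]
    refine intervalIntegral.norm_integral_le_of_norm_le hs.1 ?_ ((hint s hs.1).const_mul K)
    filter_upwards [h, volume.ae_ne b] with r hr hrb hrs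
    exact hr ⟨hrs.1, (hrs.2.trans hs.2).lt_of_ne hrb⟩
  have hφcont : ContinuousOn φ (Set.Icc a b) :=
    Set.uIcc_of_le hab ▸
      intervalIntegral.continuousOn_primitive_interval' (hint b hab) Set.left_mem_uIcc
  have hφ0 : ∀ s ∈ Set.Icc a b, φ s = 0 := by
    refine eq_zero_of_abs_deriv_le_mul_abs_self_of_eq_zero_right (K := |K|)
      hφcont (fun s hs => hφ s hs.1) (by simp [φ]) fun s hs => ?_
    rw [norm_norm, Real.norm_eq_abs, ← abs_mul]
    exact (hbound s (Set.Ico_subset_Icc_self hs)).trans (le_abs_self _)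
  intro s hs
  have := hbound s hs
  rw [hφ0 s hs, mul_zero] at this
  exact sub_eq_zero.1 (norm_le_zero_iff.1 this)

end HasVelocity

section LinearAlgebra

variable {ι κ l : Type*} [Fintype ι] [Fintype κ]

theorem mulVec_transpose_injective_of_isUnit_mul {R : Type*} [CommRing R] [DecidableEq ι]
    {J : Matrix ι κ R} {M : Matrix κ ι R} (h : IsUnit (J * M)) : Function.Injective Jᵀ.mulVec := by
  have hunit : IsUnit (Mᵀ * Jᵀ) := by rwa [← transpose_mul, isUnit_transpose]
  refine Function.Injective.of_comp (f := Mᵀ.mulVec) ?_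
  simpa only [Function.comp_def, mulVec_mulVec] using mulVec_injective_of_isUnit hunit

theorem ker_mulVecLin_eq_range_mulVecLin {K : Type*} [Field K] {G : Matrix l κ K}
    {C : Matrix κ ι K} (hGC : G * C = 0) (hC : Function.Injective C.mulVec)
    (hrank : Fintype.card κ ≤ Fintype.card ι + G.rank) :
    LinearMap.ker G.mulVecLin = LinearMap.range C.mulVecLin := by
  have hle : LinearMap.range C.mulVecLin ≤ LinearMap.ker G.mulVecLin := by
    rintro _ ⟨x, rfl⟩
    simp [hGC]
  have hrange : Module.finrank K (LinearMap.range C.mulVecLin) = Fintype.card ι := by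
    rw [LinearMap.finrank_range_of_inj (f := C.mulVecLin) hC, Module.finrank_fintype_fun_eq_card]
  have hker := LinearMap.finrank_range_add_finrank_ker G.mulVecLin
  rw [Module.finrank_fintype_fun_eq_card] at hker
  refine (Submodule.eq_of_le_of_finrank_le hle ?_).symm
  rw [Matrix.rank] at hrank
  omega

end LinearAlgebra

theorem fderiv_eq_gradVec_dotProduct {n : ℕ} (u : (Fin n → ℝ) → ℝ) (z w : Fin n → ℝ) :
    fderiv ℝ u z w = gradVec u z ⬝ᵥ w := by
  conv_lhs => rw [pi_eq_sum_univ' w, map_sum]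
  exact Finset.sum_congr rfl fun j _ => by rw [map_smul, smul_eq_mul, mul_comm, gradVec]

namespace SwitchedProblem

variable {n m p : ℕ} {P : SwitchedProblem n m p} {A B : Finset (Fin p)} {z : Fin n → ℝ}

/-- A weakening of `Admissible`: the matrices `B_A` are invertible on `Gineq` without uniform
bounds, and the dwell time `δT` is arbitrary. -/
structure Regular (P : SwitchedProblem n m p) : Prop where
  diff_f : Differentiable ℝ P.f
  diff_geq : Differentiable ℝ P.geq
  diff_gineq : Differentiable ℝ P.gineq
  κ₁_pos : 0 < P.κ₁
  κ₂_pos : 0 < P.κ₂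
  isUnit_BA : ∀ A ∈ P.indexSets, ∀ z ∈ P.Gineq, IsUnit (P.BA A z)
  annihilator : ∀ A ∈ P.indexSets, ∀ z ∈ P.Gineq,
    P.Gperp A z * (P.JA A z)ᵀ = 0 ∧ (P.Gperp A z).rank = n - m - A.card

theorem Admissible.regular (hP : P.Admissible) : P.Regular where
  diff_f := hP.diff_f
  diff_geq := hP.diff_geq
  diff_gineq := hP.diff_gineq
  κ₁_pos := hP.κ₁_pos
  κ₂_pos := hP.κ₂_pos
  isUnit_BA A hA z hz :=
    let ⟨_, _, _, _, hB⟩ := hP.B_pos A hA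
    (hB z hz).1
  annihilator := hP.annihilator

theorem fderiv_f (z w : Fin n → ℝ) : fderiv ℝ P.f z w = P.gradf z ⬝ᵥ w :=
  fderiv_eq_gradVec_dotProduct _ _ _

theorem fderiv_gineq (i : Fin p) (z w : Fin n → ℝ) :
    fderiv ℝ (fun x => P.gineq x i) z w = P.Jineq z i ⬝ᵥ w :=
  fderiv_eq_gradVec_dotProduct _ _ _

theorem mem_idx {i : Fin p} : i ∈ P.idx z ↔ P.gineq z i = 0 := by
  simp [idx]

theorem indexSets_of_subset (hB : B ∈ P.indexSets) (hAB : A ⊆ B) : A ∈ P.indexSets :=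
  let ⟨w, hw⟩ := hB
  ⟨w, hAB.trans hw⟩

/-! ### Linear algebra of the subsystems -/

theorem JA_transpose_mulVec (lam : Fin m → ℝ) {N : Fin p → ℝ} (hN : ∀ i ∉ A, N i = 0) :
    (P.JA A z)ᵀ *ᵥ Sum.elim lam (fun i => N i) = (P.Jeq z)ᵀ *ᵥ lam + (P.Jineq z)ᵀ *ᵥ N := by
  ext j
  simp only [mulVec, dotProduct, transpose_apply, JA, of_apply, Fintype.sum_sum_type,
    Sum.elim_inl, Sum.elim_inr, Pi.add_apply]
  rw [Finset.sum_coe_sort A fun i => P.Jineq z i j * N i, Finset.sum_subset A.subset_univ]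
  exact fun i _ hi => by rw [hN i hi, mul_zero]

theorem exists_JA_transpose_mulVec_eq (x : Fin m ⊕ {i // i ∈ A} → ℝ) :
    ∃ (lam : Fin m → ℝ) (N : Fin p → ℝ),
      (∀ i ∉ A, N i = 0) ∧ x = Sum.elim lam fun i : A => N i := by
  refine ⟨x ∘ Sum.inl, Function.extend Subtype.val (x ∘ Sum.inr) 0, fun i hi => ?_, ?_⟩
  · exact Function.extend_apply' _ _ _ fun ⟨j, hj⟩ => hi (hj ▸ j.2)
  · ext (i | i)
    · rfl
    · exact (Subtype.val_injective.extend_apply (x ∘ Sum.inr) 0 i).symm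

theorem h_eq (A : Finset (Fin p)) (z : Fin n → ℝ) :
    P.h A z = -(P.κ₁ • (((P.AA A z)ᵀ * (P.BA A z)⁻¹) *ᵥ Sum.elim (P.geq z) fun i => P.gineq z i))
      - P.κ₂ • ((P.Gperp A z)ᵀ *ᵥ (P.Gperp A z *ᵥ P.gradf z)) := by
  have hg : Sum.elim (P.geq z) (fun i : A => P.gineq z i) = P.AA A z *ᵥ P.gradf z + P.dA A := by
    ext (i | i) <;> rfl
  rw [hg, h, add_mulVec, smul_mulVec, smul_mulVec, mulVec_add, smul_add, mulVec_mulVec,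
    mulVec_mulVec]
  abel

namespace Regular

theorem differentiable_gineq (hP : P.Regular) (i : Fin p) :
    Differentiable ℝ fun x => P.gineq x i :=
  differentiable_pi.1 hP.diff_gineq i

theorem JA_mulVec_h (hP : P.Regular) (hA : A ∈ P.indexSets) (hz : z ∈ P.Gineq) :
    P.JA A z *ᵥ P.h A z = -(P.κ₁ • Sum.elim (P.geq z) fun i : A => P.gineq z i) := by
  have hG : P.JA A z * (P.Gperp A z)ᵀ = 0 := by
    simpa [transpose_mul] using congrArg transpose (hP.annihilator A hA z hz).1
  have hB : P.JA A z * ((P.AA A z)ᵀ * (P.BA A z)⁻¹) = 1 := by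
    rw [← Matrix.mul_assoc]
    exact mul_nonsing_inv _ ((isUnit_iff_isUnit_det _).1 (hP.isUnit_BA A hA z hz))
  rw [h_eq, mulVec_sub, mulVec_neg, mulVec_smul, mulVec_smul, mulVec_mulVec, mulVec_mulVec, hB, hG,
    one_mulVec, zero_mulVec, smul_zero, sub_zero]

theorem Jineq_dotProduct_h (hP : P.Regular) (hA : A ∈ P.indexSets) (hz : z ∈ P.Gineq)
    {i : Fin p} (hi : i ∈ A) : P.Jineq z i ⬝ᵥ P.h A z = -(P.κ₁ * P.gineq z i) :=
  congrFun (hP.JA_mulVec_h hA hz) (Sum.inr ⟨i, hi⟩)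

theorem JA_transpose_mulVec_injective (hP : P.Regular) (hA : A ∈ P.indexSets) (hz : z ∈ P.Gineq) :
    Function.Injective (P.JA A z)ᵀ.mulVec :=
  mulVec_transpose_injective_of_isUnit_mul (hP.isUnit_BA A hA z hz)

theorem eq_zero_of_combination_eq_zero (hP : P.Regular) (hA : A ∈ P.indexSets) (hz : z ∈ P.Gineq)
    {lam : Fin m → ℝ} {N : Fin p → ℝ} (hN : ∀ i ∉ A, N i = 0)
    (h : (P.Jeq z)ᵀ *ᵥ lam + (P.Jineq z)ᵀ *ᵥ N = 0) : N = 0 := by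
  rw [← JA_transpose_mulVec lam hN, ← mulVec_zero (P.JA A z)ᵀ] at h
  have hzero := hP.JA_transpose_mulVec_injective hA hz h
  ext i
  by_cases hi : i ∈ A
  · exact congrFun hzero (Sum.inr ⟨i, hi⟩)
  · exact hN i hi

theorem Gperp_mulVec_eq_zero_iff (hP : P.Regular) (hA : A ∈ P.indexSets) (hz : z ∈ P.Gineq)
    {y : Fin n → ℝ} : P.Gperp A z *ᵥ y = 0 ↔ ∃ (lam : Fin m → ℝ) (N : Fin p → ℝ),
      (∀ i ∉ A, N i = 0) ∧ (P.Jeq z)ᵀ *ᵥ lam + (P.Jineq z)ᵀ *ᵥ N = y := by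
  obtain ⟨hGJ, hrank⟩ := hP.annihilator A hA z hz
  have hker : LinearMap.ker (P.Gperp A z).mulVecLin = LinearMap.range (P.JA A z)ᵀ.mulVecLin := by
    refine ker_mulVecLin_eq_range_mulVecLin hGJ (hP.JA_transpose_mulVec_injective hA hz) ?_
    simp only [Fintype.card_sum, Fintype.card_fin, Fintype.card_coe]
    omega
  rw [← mulVecLin_apply, ← LinearMap.mem_ker, hker, LinearMap.mem_range]
  constructor
  · rintro ⟨x, rfl⟩
    obtain ⟨lam, N, hN, rfl⟩ := exists_JA_transpose_mulVec_eq x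
    exact ⟨lam, N, hN, (JA_transpose_mulVec lam hN).symm⟩
  · rintro ⟨lam, N, hN, rfl⟩
    exact ⟨_, JA_transpose_mulVec lam hN⟩

end Regular

/-- `lam` and `N` are Lagrange multipliers at `z` in the form that the KKT conditions use: `N` is a
multiplier of `IsMultiplier`, extended by zero to the constraints outside `A`. -/
structure IsExtendedMultiplier (P : SwitchedProblem n m p) (A : Finset (Fin p)) (z : Fin n → ℝ)
    (lam : Fin m → ℝ) (N : Fin p → ℝ) : Prop where
  eq_zero_of_notMem : ∀ i ∉ A, N i = 0
  stationary : P.gradf z + (P.Jeq z)ᵀ *ᵥ lam + (P.Jineq z)ᵀ *ᵥ N = 0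

theorem IsMultiplier.exists_isExtendedMultiplier {lam : Fin m → ℝ} {nu : {i // i ∈ A} → ℝ}
    (hnu : P.IsMultiplier A z lam nu) :
    ∃ N, P.IsExtendedMultiplier A z lam N ∧ ∀ i : A, N i = nu i := by
  obtain ⟨lam', N, hN, hx⟩ := exists_JA_transpose_mulVec_eq (Sum.elim lam nu)
  obtain rfl : lam = lam' := funext fun i => congrFun hx (Sum.inl i)
  obtain rfl : nu = fun i : A => N i := funext fun i => congrFun hx (Sum.inr i)
  refine ⟨N, ⟨hN, ?_⟩, fun i => rfl⟩
  rwa [IsMultiplier, JA_transpose_mulVec lam hN, ← add_assoc] at hnu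

namespace IsExtendedMultiplier

variable {lam : Fin m → ℝ} {N : Fin p → ℝ}

theorem mono (hN : P.IsExtendedMultiplier A z lam N) (hAB : A ⊆ B) :
    P.IsExtendedMultiplier B z lam N :=
  ⟨fun i hi => hN.eq_zero_of_notMem i fun hA => hi (hAB hA), hN.stationary⟩

theorem mem_of_ne_zero (hN : P.IsExtendedMultiplier A z lam N) {k : Fin p} (hk : N k ≠ 0) :
    k ∈ A :=
  by_contra fun hkA => hk (hN.eq_zero_of_notMem k hkA)

theorem nonneg_iff (hN : P.IsExtendedMultiplier A z lam N) :
    (∀ i, 0 ≤ N i) ↔ ∀ i ∈ A, 0 ≤ N i :=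
  ⟨fun h i _ => h i, fun h i =>
    if hi : i ∈ A then h i hi else (hN.eq_zero_of_notMem i hi).ge⟩

theorem KKT (hN : P.IsExtendedMultiplier (P.idx z) z lam N) (hz : z ∈ P.Gam)
    (hnonneg : ∀ i, 0 ≤ N i) : P.KKT z := by
  refine ⟨lam, N, hN.stationary, hz.2, hz.1, hnonneg, fun i => ?_⟩
  by_cases hi : i ∈ P.idx z
  · rw [mem_idx.1 hi, mul_zero]
  · rw [hN.eq_zero_of_notMem i hi, zero_mul]

end IsExtendedMultiplier

theorem Regular.Gperp_mulVec_gradf_eq_zero_iff (hP : P.Regular) (hA : A ∈ P.indexSets)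
    (hz : z ∈ P.Gineq) :
    P.Gperp A z *ᵥ P.gradf z = 0 ↔ ∃ lam N, P.IsExtendedMultiplier A z lam N := by
  rw [← neg_eq_zero, ← mulVec_neg, hP.Gperp_mulVec_eq_zero_iff hA hz]
  refine exists_congr fun lam => exists_congr fun N => ?_
  rw [← add_eq_zero_iff_eq_neg', ← add_assoc]
  exact ⟨fun h => ⟨h.1, h.2⟩, fun h => ⟨h.1, h.2⟩⟩

theorem h_eq_of_subset_idx (hz : z ∈ P.Geq) (hA : A ⊆ P.idx z) :
    P.h A z = -(P.κ₂ • ((P.Gperp A z)ᵀ *ᵥ (P.Gperp A z *ᵥ P.gradf z))) := by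
  have hg : Sum.elim (P.geq z) (fun i : {i // i ∈ A} => P.gineq z i) = 0 := by
    ext (i | i)
    · exact congrFun hz i
    · exact mem_idx.1 (hA i.2)
  rw [h_eq, hg, mulVec_zero, smul_zero, neg_zero, zero_sub]

theorem dotProduct_h_of_subset_idx (hz : z ∈ P.Geq) (hA : A ⊆ P.idx z) (x : Fin n → ℝ) :
    x ⬝ᵥ P.h A z = -(P.κ₂ * ((P.Gperp A z *ᵥ x) ⬝ᵥ (P.Gperp A z *ᵥ P.gradf z))) := by
  rw [h_eq_of_subset_idx hz hA, dotProduct_neg, dotProduct_smul, dotProduct_transpose_mulVec,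
    dotProduct_comm, smul_eq_mul]

theorem Regular.h_eq_zero_iff (hP : P.Regular) (hA : A ∈ P.indexSets) (hz : z ∈ P.Gineq) :
    P.h A z = 0 ↔ z ∈ P.Gam ∧ A ⊆ P.idx z ∧ ∃ lam N, P.IsExtendedMultiplier A z lam N := by
  rw [← hP.Gperp_mulVec_gradf_eq_zero_iff hA hz]
  refine ⟨fun h0 => ?_, fun ⟨hgam, hsub, hG⟩ => ?_⟩
  · have hg := hP.JA_mulVec_h hA hz
    rw [h0, mulVec_zero, eq_comm, neg_eq_zero, smul_eq_zero, or_iff_right hP.κ₁_pos.ne'] at hg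
    have hgeq : z ∈ P.Geq := funext fun i => congrFun hg (Sum.inl i)
    have hsub : A ⊆ P.idx z := fun i hi => mem_idx.2 (congrFun hg (Sum.inr ⟨i, hi⟩))
    have hgrad := dotProduct_h_of_subset_idx hgeq hsub (P.gradf z)
    rw [h0, dotProduct_zero, eq_comm, neg_eq_zero, mul_eq_zero, or_iff_right hP.κ₂_pos.ne',
      dotProduct_self_eq_zero] at hgrad
    exact ⟨⟨hz, hgeq⟩, hsub, hgrad⟩
  · rw [h_eq_of_subset_idx hgam.2 hsub, hG, mulVec_zero, smul_zero, neg_zero]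

theorem Regular.h_idx_eq_zero (hP : P.Regular) (hA : A ∈ P.indexSets) (hz : z ∈ P.Gineq)
    (h0 : P.h A z = 0) : P.h (P.idx z) z = 0 := by
  obtain ⟨hgam, hsub, lam, N, hN⟩ := (hP.h_eq_zero_iff hA hz).1 h0
  exact (hP.h_eq_zero_iff ⟨z, subset_rfl⟩ hz).2 ⟨hgam, subset_rfl, lam, N, hN.mono hsub⟩

theorem Regular.Gperp_sdiff_mulVec_Jineq_ne_zero (hP : P.Regular) (hA : A ∈ P.indexSets)
    (hz : z ∈ P.Gineq) {k : Fin p} (hk : k ∈ A) : P.Gperp (A \ {k}) z *ᵥ P.Jineq z k ≠ 0 := by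
  intro h0
  obtain ⟨lam, N, hN, hcomb⟩ :=
    (hP.Gperp_mulVec_eq_zero_iff (indexSets_of_subset hA Finset.sdiff_subset) hz).1 h0
  have hdiff : N - Pi.single k 1 = 0 := by
    refine hP.eq_zero_of_combination_eq_zero hA hz (lam := lam) (fun i hi => ?_) ?_
    · have hik : i ≠ k := fun hik => hi (hik ▸ hk)
      simp [hik, hN i fun hi' => hi (Finset.sdiff_subset hi')]
    · rw [mulVec_sub, mulVec_single_one, ← add_sub_assoc, hcomb]
      exact sub_self _
  have hNk := congrFun hdiff k
  simp [hN k (by simp)] at hNk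

namespace IsExtendedMultiplier

variable {lam : Fin m → ℝ} {N : Fin p → ℝ} {k : Fin p}

theorem Gperp_sdiff_mulVec_gradf (hN : P.IsExtendedMultiplier A z lam N) (hP : P.Regular)
    (hA : A ∈ P.indexSets) (hz : z ∈ P.Gineq) :
    P.Gperp (A \ {k}) z *ᵥ P.gradf z = -(N k • (P.Gperp (A \ {k}) z *ᵥ P.Jineq z k)) := by
  rw [eq_neg_iff_add_eq_zero, ← mulVec_smul, ← mulVec_add,
    hP.Gperp_mulVec_eq_zero_iff (indexSets_of_subset hA Finset.sdiff_subset) hz]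
  refine ⟨-lam, Pi.single k (N k) - N, fun i hi => ?_, ?_⟩
  · rcases eq_or_ne i k with rfl | hik
    · simp
    · simp [hik, hN.eq_zero_of_notMem i fun hiA => hi (by simp [hiA, hik])]
  · have hk : (P.Jineq z)ᵀ *ᵥ Pi.single k (N k) = N k • P.Jineq z k := by
      ext j
      simp [mul_comm]
    rw [mulVec_neg, mulVec_sub, hk, ← sub_eq_zero, ← neg_eq_zero, ← hN.stationary]
    abel

theorem Jineq_dotProduct_h_sdiff_neg_iff (hN : P.IsExtendedMultiplier A z lam N)
    (hP : P.Regular) (hz : z ∈ P.Gam) (hA : A ⊆ P.idx z) (hk : k ∈ A) :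
    P.Jineq z k ⬝ᵥ P.h (A \ {k}) z < 0 ↔ N k < 0 := by
  have hne := hP.Gperp_sdiff_mulVec_Jineq_ne_zero ⟨z, hA⟩ hz.1 hk
  set G := P.Gperp (A \ {k}) z
  have hpos : 0 < P.κ₂ * ((G *ᵥ P.Jineq z k) ⬝ᵥ (G *ᵥ P.Jineq z k)) :=
    mul_pos hP.κ₂_pos (dotProduct_self_star_pos_iff.2 hne)
  have heq : P.Jineq z k ⬝ᵥ P.h (A \ {k}) z =
      P.κ₂ * ((G *ᵥ P.Jineq z k) ⬝ᵥ (G *ᵥ P.Jineq z k)) * N k := by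
    rw [dotProduct_h_of_subset_idx hz.2 (Finset.sdiff_subset.trans hA),
      hN.Gperp_sdiff_mulVec_gradf hP ⟨z, hA⟩ hz.1, dotProduct_neg, dotProduct_smul, smul_eq_mul]
    ring
  rw [heq, ← neg_pos, ← mul_neg, mul_pos_iff_of_pos_left hpos, neg_pos]

theorem fderiv_f_h_sdiff_neg (hN : P.IsExtendedMultiplier A z lam N) (hP : P.Regular)
    (hz : z ∈ P.Gam) (hA : A ⊆ P.idx z) (hk : N k ≠ 0) :
    fderiv ℝ P.f z (P.h (A \ {k}) z) < 0 := by
  have hkA : k ∈ A := hN.mem_of_ne_zero hk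
  have hG : P.Gperp (A \ {k}) z *ᵥ P.gradf z ≠ 0 := by
    rw [hN.Gperp_sdiff_mulVec_gradf hP ⟨z, hA⟩ hz.1]
    exact neg_ne_zero.2 (smul_ne_zero hk (hP.Gperp_sdiff_mulVec_Jineq_ne_zero ⟨z, hA⟩ hz.1 hkA))
  rw [fderiv_f, dotProduct_h_of_subset_idx hz.2 (Finset.sdiff_subset.trans hA), neg_lt_zero]
  exact mul_pos hP.κ₂_pos (dotProduct_self_star_pos_iff.2 hG)

end IsExtendedMultiplier

/-! ### The switching law at a point -/

section Law

variable {s s' : Finset (Fin p)} {t τ τ' : ℝ}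

theorem addIdx_subset_idx (z : Fin n → ℝ) (s : Finset (Fin p)) : P.addIdx z s ⊆ P.idx z :=
  (Finset.filter_subset _ _).trans Finset.sdiff_subset

theorem mem_union_addIdx {i : Fin p} (hi : i ∈ P.idx z) (h : 0 ≤ P.Jineq z i ⬝ᵥ P.h s z) :
    i ∈ s ∪ P.addIdx z s := by
  by_cases his : i ∈ s
  · exact Finset.mem_union_left _ his
  · exact Finset.mem_union_right _ (Finset.mem_filter.2 ⟨Finset.mem_sdiff.2 ⟨hi, his⟩, h⟩)

theorem union_addIdx_of_h_eq_zero (hs : s ⊆ P.idx z) (h0 : P.h s z = 0) :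
    s ∪ P.addIdx z s = P.idx z := by
  refine Finset.Subset.antisymm (Finset.union_subset hs (addIdx_subset_idx z s)) fun i hi => ?_
  exact mem_union_addIdx hi (by rw [h0, dotProduct_zero])

theorem DelayedStep.subset_idx (h : P.DelayedStep t z s τ s' τ') (hs : s ⊆ P.idx z) :
    s' ⊆ P.idx z := by
  have hunion : s ∪ P.addIdx z s ⊆ P.idx z := Finset.union_subset hs (addIdx_subset_idx z s)
  rcases h with ⟨rfl, -⟩ | ⟨k, -, rfl, -⟩
  · exact hunion
  · exact Finset.sdiff_subset.trans hunion

theorem DelayedStep.union_addIdx_eq_self (h : P.DelayedStep t z s τ s τ') :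
    s ∪ P.addIdx z s = s ∧ τ' = τ := by
  rcases h with ⟨hs, hτ⟩ | ⟨k, hk, hs, -⟩
  · exact ⟨hs.symm, hτ⟩
  · have hks : k ∈ s := hk.1
    rw [hs] at hks
    simp at hks

namespace IsExtendedMultiplier

variable {lam : Fin m → ℝ} {N : Fin p → ℝ} {k : Fin p}

theorem removable_iff (hN : P.IsExtendedMultiplier A z lam N) (hP : P.Regular) (hz : z ∈ P.Gam)
    (hA : A ⊆ P.idx z) : P.Removable t z A τ k ↔ N k < 0 ∧ τ + P.δT < t := by
  constructor
  · rintro ⟨hk, hneg, ht⟩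
    exact ⟨(hN.Jineq_dotProduct_h_sdiff_neg_iff hP hz hA hk).1 hneg, ht⟩
  · rintro ⟨hneg, ht⟩
    have hk : k ∈ A := hN.mem_of_ne_zero hneg.ne
    exact ⟨hk, (hN.Jineq_dotProduct_h_sdiff_neg_iff hP hz hA hk).2 hneg, ht⟩

theorem not_removable (hN : P.IsExtendedMultiplier A z lam N) (hP : P.Regular) (hz : z ∈ P.Gam)
    (hA : A ⊆ P.idx z) (hk : 0 ≤ N k) : ¬ P.Removable t z A τ k :=
  fun h => hk.not_gt ((hN.removable_iff hP hz hA).1 h).1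

theorem union_addIdx (hN : P.IsExtendedMultiplier A z lam N) (hP : P.Regular) (hz : z ∈ P.Gam)
    (hA : A ⊆ P.idx z) : A ∪ P.addIdx z A = P.idx z :=
  union_addIdx_of_h_eq_zero hA ((hP.h_eq_zero_iff ⟨z, hA⟩ hz.1).2 ⟨hz, hA, lam, N, hN⟩)

theorem lawStep_iff_of_nonneg (hN : P.IsExtendedMultiplier A z lam N) (hP : P.Regular)
    (hz : z ∈ P.Gam) (hA : A ⊆ P.idx z) (hnonneg : ∀ i, 0 ≤ N i) :
    P.LawStep t z A τ s' τ' ↔ s' = P.idx z ∧ τ' = τ := by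
  simp [LawStep, hN.not_removable hP hz hA (hnonneg _), hN.union_addIdx hP hz hA]

theorem delayedStep_iff_of_nonneg (hN : P.IsExtendedMultiplier A z lam N) (hP : P.Regular)
    (hz : z ∈ P.Gam) (hA : A ⊆ P.idx z) (hnonneg : ∀ i, 0 ≤ N i) :
    P.DelayedStep t z A τ s' τ' ↔ s' = P.idx z ∧ τ' = τ := by
  simp [DelayedStep, hN.not_removable hP hz hA (hnonneg _), hN.union_addIdx hP hz hA]

theorem lawStep_iff_of_neg (hN : P.IsExtendedMultiplier A z lam N) (hP : P.Regular)
    (hz : z ∈ P.Gam) (hA : A ⊆ P.idx z) (ht : τ + P.δT < t) (hk : N k < 0) :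
    P.LawStep t z A τ s' τ' ↔ ∃ j, N j < 0 ∧ s' = P.idx z \ {j} ∧ τ' = t := by
  have hremovable : ∀ j, P.Removable t z A τ j ↔ N j < 0 := fun j => by
    rw [hN.removable_iff hP hz hA, and_iff_left ht]
  simp only [LawStep, hremovable, hN.union_addIdx hP hz hA]
  exact or_iff_right fun h => h.1 k hk

end IsExtendedMultiplier

end Law

/-! ### Trajectories -/

section Run

variable {step : ℝ → (Fin n → ℝ) → Finset (Fin p) → ℝ → Finset (Fin p) → ℝ → Prop}
  {y : ℝ → Fin n → ℝ} {σ : ℝ → Finset (Fin p)} {T : ℝ → ℝ}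
  {s : Finset (Fin p)} {a b t : ℝ}

namespace IsRun

theorem hasVelocity (hr : P.IsRun step y σ T) : HasVelocity y fun t => P.h (σ t) (y t) :=
  ⟨hr.integrable, hr.solution⟩

theorem induction_of_isClosed (hr : P.IsRun step y σ T)
    {Q : (Fin n → ℝ) → Finset (Fin p) → ℝ → Prop} (hQ : ∀ s τ, IsClosed {x | Q x s τ})
    (ha : 0 ≤ a) (hbase : Q (y a) (σ a) (T a))
    (hstep : ∀ t, a ≤ t → Q (y t) (σ t) (T t) → ∀ s' τ', step t (y t) (σ t) (T t) s' τ' →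
      ∀ b, t < b → (∀ r ∈ Set.Ioo t b, σ r = s') → ∀ᶠ r in 𝓝[>] t, Q (y r) s' τ') :
    ∀ t, a ≤ t → Q (y t) (σ t) (T t) := by
  intro b hab
  refine forall_mem_Icc_of_nhdsGT (Q := fun t => Q (y t) (σ t) (T t)) hbase ?_ ?_ b ⟨hab, le_rfl⟩
  · intro t ht hQt
    obtain ⟨s', τ', hs', hconst⟩ := hr.update t (ha.trans ht.1)
    obtain ⟨c, htc, hc⟩ := mem_nhdsGT_iff_exists_Ioo_subset.1 hconst
    filter_upwards [hstep t ht.1 hQt s' τ' hs' c htc fun r hr => (hc hr).1, hconst]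
      with r hQr ⟨hσ, hT⟩
    rwa [hσ, hT]
  · intro t ht hbelow
    have hy : Tendsto y (𝓝[<] t) (𝓝 (y t)) :=
      (hr.hasVelocity.tendsto_nhds (ha.trans_lt ht.1)).mono_left nhdsWithin_le_nhds
    refine (hQ (σ t) (T t)).mem_of_tendsto hy ?_
    filter_upwards [hr.left t (ha.trans_lt ht.1), Ioo_mem_nhdsLT ht.1] with r ⟨hσ, hT⟩ hrt
    rw [← hσ, ← hT]
    exact hbelow r ⟨hrt.1.le, hrt.2⟩

theorem union_addIdx_of_const (hr : P.IsRun P.DelayedStep y σ T) (ha : 0 ≤ a)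
    (hσ : ∀ r ∈ Set.Ioo a b, σ r = s) (ht : t ∈ Set.Ioo a b) : s ∪ P.addIdx (y t) s = s := by
  obtain ⟨s', τ', hstep, hconst⟩ := hr.update t (ha.trans ht.1.le)
  obtain ⟨r, ⟨hr', -⟩, htr⟩ := (hconst.and (Ioo_mem_nhdsGT ht.2)).exists
  obtain rfl : s' = s := hr'.symm.trans (hσ r ⟨ht.1.trans htr.1, htr.2⟩)
  rw [hσ t ht] at hstep
  exact hstep.union_addIdx_eq_self.1

theorem exists_Ioo_const_of_pos (hr : P.IsRun step y σ T) (ht : 0 < t) :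
    ∃ a ∈ Set.Ico 0 t, ∀ r ∈ Set.Ioo a t, σ r = σ t := by
  obtain ⟨a, ha, hsub⟩ := (mem_nhdsLT_iff_exists_mem_Ico_Ioo_subset ht).1 (hr.left t ht)
  exact ⟨a, ha, fun r hr => (hsub hr).1⟩

theorem h_eq_zero_of_rest (hr : P.IsRun step y σ T) (hy : ∀ t, 0 ≤ t → y t = z) (ht : 0 < t) :
    P.h (σ t) z = 0 := by
  have hae : ∀ᵐ r : ℝ, 0 < r → P.h (σ r) z = 0 := by
    filter_upwards [hr.hasVelocity.ae_hasDerivAt] with r hderiv hr0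
    have hconst : HasDerivAt y 0 r := (hasDerivAt_const r z).congr_of_eventuallyEq <|
      (eventually_gt_nhds hr0).mono fun x hx => hy x hx.le
    rw [← (hderiv hr0).unique hconst, hy r hr0.le]
  obtain ⟨a, ⟨ha, hat⟩, hconst⟩ := hr.exists_Ioo_const_of_pos ht
  obtain ⟨r, hr0, hrat⟩ := (Measure.dense_of_ae hae).exists_between hat
  rw [← hconst r hrat]
  exact hr0 (ha.trans_lt hrat.1)

theorem eq_idx_of_rest (hr : P.IsRun P.DelayedStep y σ T) (hP : P.Regular)
    (hy : ∀ t, 0 ≤ t → y t = z) (ht : 0 < t) : σ t = P.idx z := by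
  have hz : z ∈ P.Gineq := hy 0 le_rfl ▸ hr.init
  have h0 := hr.h_eq_zero_of_rest hy ht
  obtain ⟨a, ⟨ha, hat⟩, hconst⟩ := hr.exists_Ioo_const_of_pos ht
  obtain ⟨r, hrat⟩ := exists_between hat
  have hunion := hr.union_addIdx_of_const ha hconst hrat
  rw [hy r (ha.trans hrat.1.le), union_addIdx_of_h_eq_zero
    ((hP.h_eq_zero_iff (hr.mem t ht.le) hz).1 h0).2.1 h0] at hunion
  exact hunion.symm

theorem clock_eq_of_rest (hr : P.IsRun P.DelayedStep y σ T) (hP : P.Regular)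
    (hy : ∀ t, 0 ≤ t → y t = z) (ha : 0 < a) : ∀ t, a ≤ t → T t = T a := by
  refine hr.induction_of_isClosed (Q := fun _ _ τ => τ = T a) (fun _ _ => isClosed_const) ha.le
    rfl fun t hat hTt s' τ' hstep b htb hconst => ?_
  have ht : 0 < t := ha.trans_le hat
  obtain ⟨r, hrtb⟩ := exists_between htb
  obtain rfl : s' = σ t := by
    rw [← hconst r hrtb, hr.eq_idx_of_rest hP hy ht, hr.eq_idx_of_rest hP hy (ht.trans hrtb.1)]
  exact Eventually.of_forall fun _ => hstep.union_addIdx_eq_self.2.trans hTt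

/- The clock is frozen, so a negative multiplier would qualify its index for removal at all late
times. -/
theorem multiplier_nonneg_of_rest (hr : P.IsRun P.DelayedStep y σ T) (hP : P.Regular)
    (hfreq : ∀ k, ∃ᶠ t in atTop, ¬ P.Removable t (y t) (σ t) (T t) k)
    (hy : ∀ t, 0 ≤ t → y t = z) {lam : Fin m → ℝ} {N : Fin p → ℝ}
    (hN : P.IsExtendedMultiplier (P.idx z) z lam N) (k : Fin p) : 0 ≤ N k := by
  have hz : z ∈ P.Gam := ((hP.h_eq_zero_iff (hr.mem 1 zero_le_one) (hy 0 le_rfl ▸ hr.init)).1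
    (hr.h_eq_zero_of_rest hy one_pos)).1
  by_contra! hk
  refine hfreq k ?_
  filter_upwards [eventually_ge_atTop 1, eventually_gt_atTop (T 1 + P.δT)] with t ht htT
  have ht0 : 0 < t := one_pos.trans_le ht
  rw [not_not, hy t ht0.le, hr.eq_idx_of_rest hP hy ht0, hr.clock_eq_of_rest hP hy one_pos t ht,
    hN.removable_iff hP hz subset_rfl]
  exact ⟨hk, htT⟩

theorem subset_idx_of_const (hr : P.IsRun step y σ T) (hP : P.Regular)
    (hfeas : ∀ t, 0 ≤ t → y t ∈ P.Gineq) (ha : 0 ≤ a) (hσ : ∀ r ∈ Set.Ioo a b, σ r = s)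
    (hs : s ⊆ P.idx (y a)) (ht : t ∈ Set.Ioo a b) : s ⊆ P.idx (y t) := by
  intro i hi
  have hsS : s ∈ P.indexSets := hσ t ht ▸ hr.mem t (ha.trans ht.1.le)
  have hmono : P.gineq (y a) i ≤ P.gineq (y t) i := by
    refine hr.hasVelocity.le_of_ae_fderiv_nonneg (hP.differentiable_gineq i) ha ht.1.le
      (Eventually.of_forall fun x hx => ?_)
    have hx0 : 0 ≤ x := ha.trans hx.1.le
    rw [hσ x ⟨hx.1, hx.2.trans ht.2⟩, fderiv_gineq, hP.Jineq_dotProduct_h hsS (hfeas x hx0) hi,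
      neg_nonneg]
    exact mul_nonpos_of_nonneg_of_nonpos hP.κ₁_pos.le (hfeas x hx0 i)
  rw [mem_idx.1 (hs hi)] at hmono
  exact mem_idx.2 (le_antisymm (hfeas t (ha.trans ht.1.le) i) hmono)

theorem Jineq_dotProduct_h_eq_zero_of_hasDerivAt (hP : P.Regular)
    (hfeas : ∀ t, 0 ≤ t → y t ∈ P.Gineq) (ht : 0 < t) {w : Fin n → ℝ} (hy : HasDerivAt y w t)
    {i : Fin p} (hi : i ∈ P.idx (y t)) : P.Jineq (y t) i ⬝ᵥ w = 0 := by
  have hderiv := (hP.differentiable_gineq i (y t)).hasFDerivAt.comp_hasDerivAt t hy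
  rw [fderiv_gineq] at hderiv
  refine IsLocalMax.hasDerivAt_eq_zero ?_ hderiv
  filter_upwards [Ioi_mem_nhds ht] with x hx
  exact (hfeas x (le_of_lt hx) i).trans_eq (mem_idx.1 hi).symm

theorem eq_idx_of_const (hr : P.IsRun P.DelayedStep y σ T) (hP : P.Regular)
    (hfeas : ∀ t, 0 ≤ t → y t ∈ P.Gineq) (ha : 0 ≤ a) (hσ : ∀ r ∈ Set.Ioo a b, σ r = s)
    (hs : s ⊆ P.idx (y a)) (ht : t ∈ Set.Ioo a b) (hy : HasDerivAt y (P.h s (y t)) t) :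
    s = P.idx (y t) := by
  refine (hr.subset_idx_of_const hP hfeas ha hσ hs ht).antisymm fun i hi => ?_
  rw [← hr.union_addIdx_of_const ha hσ ht]
  exact mem_union_addIdx hi
    (Jineq_dotProduct_h_eq_zero_of_hasDerivAt hP hfeas (ha.trans_lt ht.1) hy hi).ge

theorem eq_of_const (hr : P.IsRun P.DelayedStep y σ T) (hP : P.Regular)
    (hfeas : ∀ t, 0 ≤ t → y t ∈ P.Gineq) (hzero : ∀ t, 0 ≤ t → P.h (P.idx (y t)) (y t) = 0)
    (ha : 0 ≤ a) (hσ : ∀ r ∈ Set.Ioo a b, σ r = s) (hs : s ⊆ P.idx (y a)) :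
    ∀ t ∈ Set.Icc a b, y t = y a := by
  refine hr.hasVelocity.eq_of_ae_norm_le_mul_norm_sub ha (K := 0) ?_
  filter_upwards [hr.hasVelocity.ae_hasDerivAt] with t hy ht
  have ht0 : 0 < t := ha.trans_lt ht.1
  have hidx : s = P.idx (y t) := hr.eq_idx_of_const hP hfeas ha hσ hs ht (hσ t ht ▸ hy ht0)
  rw [hσ t ht, hidx, hzero t ht0.le, norm_zero, zero_mul]

theorem rest_of_h_idx_eq_zero (hr : P.IsRun P.DelayedStep y σ T) (hP : P.Regular)
    (hfeas : ∀ t, 0 ≤ t → y t ∈ P.Gineq) (hzero : ∀ t, 0 ≤ t → P.h (P.idx (y t)) (y t) = 0)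
    (hσ0 : σ 0 ⊆ P.idx (y 0)) : ∀ t, 0 ≤ t → y t = y 0 := by
  suffices ∀ t, 0 ≤ t → y t = y 0 ∧ σ t ⊆ P.idx (y 0) from fun t ht => (this t ht).1
  refine hr.induction_of_isClosed (Q := fun x s _ => x = y 0 ∧ s ⊆ P.idx (y 0))
    (fun _ _ => isClosed_eq continuous_id continuous_const |>.inter isClosed_const) le_rfl
    ⟨rfl, hσ0⟩ ?_
  rintro t ht ⟨hyt, hσt⟩ s' τ' hstep b htb hconst
  rw [← hyt] at hσt ⊢
  have hs' : s' ⊆ P.idx (y t) := hstep.subset_idx hσt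
  filter_upwards [Ioo_mem_nhdsGT htb] with r hrtb
  exact ⟨hr.eq_of_const hP hfeas hzero ht hconst hs' r (Set.Ioo_subset_Icc_self hrtb), hs'⟩

theorem rest_of_lipschitzOnWith (hr : P.IsRun P.DelayedStep y σ T) (hP : P.Regular)
    (hz : z ∈ P.Gam) {lam : Fin m → ℝ} {N : Fin p → ℝ}
    (hN : P.IsExtendedMultiplier (P.idx z) z lam N) (hnonneg : ∀ i, 0 ≤ N i) {K : NNReal}
    {U : Set (Fin n → ℝ)} (hU : U ∈ 𝓝 z) (hLip : LipschitzOnWith K (P.h (P.idx z)) U)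
    (hy0 : y 0 = z) (hσ0 : σ 0 = P.idx z) : ∀ t, 0 ≤ t → y t = z ∧ σ t = P.idx z := by
  have h0 : P.h (P.idx z) z = 0 :=
    (hP.h_eq_zero_iff ⟨z, subset_rfl⟩ hz.1).2 ⟨hz, subset_rfl, lam, N, hN⟩
  refine hr.induction_of_isClosed (Q := fun x s _ => x = z ∧ s = P.idx z)
    (fun _ _ => isClosed_eq continuous_id continuous_const |>.inter isClosed_const) le_rfl
    ⟨hy0, hσ0⟩ ?_
  rintro t ht ⟨hyt, hσt⟩ s' τ' hstep b htb hconst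
  rw [hyt, hσt, hN.delayedStep_iff_of_nonneg hP hz subset_rfl hnonneg] at hstep
  obtain ⟨c, htc, hc⟩ := mem_nhdsGT_iff_exists_Ioo_subset.1 <|
    (hr.hasVelocity.tendsto_nhdsGT ht).eventually (hyt ▸ hU)
  have hrest : ∀ r ∈ Set.Icc t (min b c), y r = y t := by
    refine hr.hasVelocity.eq_of_ae_norm_le_mul_norm_sub ht (K := K)
      (Eventually.of_forall fun r hrbc => ?_)
    have hσr : σ r = P.idx z :=
      (hconst r ⟨hrbc.1, hrbc.2.trans_le (min_le_left _ _)⟩).trans hstep.1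
    have hyr : y r ∈ U := hc ⟨hrbc.1, hrbc.2.trans_le (min_le_right _ _)⟩
    simpa only [hσr, hyt, h0, sub_zero] using hLip.norm_sub_le hyr (mem_of_mem_nhds hU)
  filter_upwards [Ioo_mem_nhdsGT (lt_min htb htc)] with r hrbc
  exact ⟨(hrest r (Set.Ioo_subset_Icc_self hrbc)).trans hyt, hstep.1⟩

end IsRun

end Run

section Invariant

variable {F : Set ((ℝ → Fin n → ℝ) × (ℝ → Finset (Fin p)))} {c : ℝ}
  {lam : Fin m → ℝ} {N : Fin p → ℝ}

theorem Regular.exists_isExtendedMultiplier_of_mem_Omega (hP : P.Regular) (hz : z ∈ P.Omega c) :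
    ∃ lam N, P.IsExtendedMultiplier (P.idx z) z lam N := by
  obtain ⟨-, hgam, A, hA, hsub, hG⟩ := hz
  obtain ⟨lam, N, hN⟩ := (hP.Gperp_mulVec_gradf_eq_zero_iff hA hgam.1).1 hG
  exact ⟨lam, N, hN.mono hsub⟩

theorem Regular.h_idx_eq_zero_of_mem_Omega (hP : P.Regular) (hz : z ∈ P.Omega c) :
    P.h (P.idx z) z = 0 :=
  (hP.h_eq_zero_iff ⟨z, subset_rfl⟩ hz.2.1.1).2
    ⟨hz.2.1, subset_rfl, hP.exists_isExtendedMultiplier_of_mem_Omega hz⟩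

theorem Regular.exists_rest_of_mem_largestInvariant (hP : P.Regular) (hF : F ⊆ P.delayedFamily)
    {x : (Fin n → ℝ) × Finset (Fin p)} (hx : x ∈ P.largestInvariant F (P.Omega c)) :
    ∃ y ∈ F, ∀ t, 0 ≤ t → y.1 t = x.1 := by
  obtain ⟨M, ⟨⟨-, -, hM⟩, hMΩ⟩, hxM⟩ := hx
  obtain ⟨y, hyF, hy0, -, hyM⟩ := hM x hxM
  obtain ⟨T, hr, hσ0, -⟩ := hF hyF
  have hΩ : ∀ t, 0 ≤ t → y.1 t ∈ P.Omega c := fun t ht => hMΩ _ (hyM t ht)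
  exact ⟨y, hyF, hy0 ▸ hr.rest_of_h_idx_eq_zero hP (fun t ht => (hΩ t ht).2.1.1)
    (fun t ht => hP.h_idx_eq_zero_of_mem_Omega (hΩ t ht)) hσ0⟩

theorem IsExtendedMultiplier.nonneg_of_rest (hN : P.IsExtendedMultiplier (P.idx z) z lam N)
    (hP : P.Regular) {y : (ℝ → Fin n → ℝ) × (ℝ → Finset (Fin p))} (hy : y ∈ P.delayedFamily)
    (hrest : ∀ t, 0 ≤ t → y.1 t = z) (k : Fin p) : 0 ≤ N k := by
  obtain ⟨T, hr, -, hfreq⟩ := hy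
  exact hr.multiplier_nonneg_of_rest hP hfreq hrest hN k

theorem Regular.KKT_of_mem_largestInvariant (hP : P.Regular) (hF : F ⊆ P.delayedFamily)
    {x : (Fin n → ℝ) × Finset (Fin p)} (hx : x ∈ P.largestInvariant F (P.Omega c)) :
    P.KKT x.1 := by
  have hΩ : x.1 ∈ P.Omega c := let ⟨_, ⟨_, hMΩ⟩, hxM⟩ := hx; hMΩ x hxM
  obtain ⟨y, hyF, hrest⟩ := hP.exists_rest_of_mem_largestInvariant hF hx
  obtain ⟨lam, N, hN⟩ := hP.exists_isExtendedMultiplier_of_mem_Omega hΩ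
  exact hN.KKT hΩ.2.1 (hN.nonneg_of_rest hP (hF hyF) hrest)

theorem IsExtendedMultiplier.exists_ne_of_neg (hN : P.IsExtendedMultiplier (P.idx z) z lam N)
    (hP : P.Regular) {k : Fin p} (hk : N k < 0) {y : (ℝ → Fin n → ℝ) × (ℝ → Finset (Fin p))}
    (hy : y ∈ P.delayedFamily) : ∃ t, 0 ≤ t ∧ y.1 t ≠ z := by
  by_contra! hrest
  exact hk.not_ge (hN.nonneg_of_rest hP hy hrest k)

theorem IsExtendedMultiplier.notMem_largestInvariant_of_neg
    (hN : P.IsExtendedMultiplier (P.idx z) z lam N) (hP : P.Regular) {k : Fin p} (hk : N k < 0)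
    (hF : F ⊆ P.delayedFamily) (s : Finset (Fin p)) :
    (z, s) ∉ P.largestInvariant F (P.Omega c) := by
  intro hz
  obtain ⟨y, hyF, hrest⟩ := hP.exists_rest_of_mem_largestInvariant hF hz
  exact hk.not_ge (hN.nonneg_of_rest hP (hF hyF) hrest k)

theorem IsExtendedMultiplier.rest_mem_promptFamily
    (hN : P.IsExtendedMultiplier (P.idx z) z lam N) (hP : P.Regular) (hz : z ∈ P.Gam)
    (hnonneg : ∀ i, 0 ≤ N i) :
    ((fun _ => z, fun _ => P.idx z) : (ℝ → Fin n → ℝ) × (ℝ → Finset (Fin p))) ∈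
      P.promptFamily := by
  have h0 : P.h (P.idx z) z = 0 :=
    (hP.h_eq_zero_iff ⟨z, subset_rfl⟩ hz.1).2 ⟨hz, subset_rfl, lam, N, hN⟩
  refine ⟨fun _ => 0, ?_, rfl⟩
  exact
    { init := hz.1
      clock := le_rfl
      mem := fun _ _ => ⟨z, subset_rfl⟩
      integrable := fun t _ =>
        (intervalIntegrable_const : IntervalIntegrable (fun _ => P.h (P.idx z) z) volume 0 t)
      solution := fun _ _ => by simp [h0]
      left := fun _ _ => Eventually.of_forall fun _ => ⟨rfl, rfl⟩
      update := fun _ _ => ⟨P.idx z, 0,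
        (hN.lawStep_iff_of_nonneg hP hz subset_rfl hnonneg).2 ⟨rfl, rfl⟩,
        Eventually.of_forall fun _ => ⟨rfl, rfl⟩⟩ }

theorem IsExtendedMultiplier.weaklyInvariant_singleton
    (hN : P.IsExtendedMultiplier (P.idx z) z lam N) (hP : P.Regular) (hz : z ∈ P.Gam)
    (hnonneg : ∀ i, 0 ≤ N i) (hF : P.promptFamily ⊆ F) : P.WeaklyInvariant F {(z, P.idx z)} := by
  refine ⟨Set.singleton_nonempty _, ?_, ?_⟩
  · rintro x rfl
    exact ⟨z, subset_rfl⟩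
  · rintro x rfl
    exact ⟨_, hF (hN.rest_mem_promptFamily hP hz hnonneg), rfl, rfl, fun _ _ => rfl⟩

end Invariant

end SwitchedProblem

theorem proposition6_general {n m p : ℕ} (P : SwitchedProblem n m p) (hP : P.Regular)
    (F : Set ((ℝ → Fin n → ℝ) × (ℝ → Finset (Fin p))))
    (hF₁ : P.promptFamily ⊆ F) (hF₂ : F ⊆ P.delayedFamily) :
    (∀ c : ℝ, ∀ x ∈ P.largestInvariant F (P.Omega c), P.KKT x.1) ∧
    (∀ A ∈ P.indexSets, ∀ z ∈ P.Gineq, P.h A z = 0 →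
      ∀ (lam : Fin m → ℝ) (nu : {i // i ∈ A} → ℝ), P.IsMultiplier A z lam nu →
      ∀ k : {i // i ∈ A}, nu k < 0 →
        P.Jineq z k ⬝ᵥ P.h (A \ {k.1}) z < 0 ∧
        fderiv ℝ P.f z (P.h (A \ {k.1}) z) < 0 ∧
        (∀ t τ : ℝ, τ + P.δT < t →
          P.LawStep t z A τ (P.idx z \ {k.1}) t ∧
          ∀ s' τ', P.LawStep t z A τ s' τ' →
            (∃ j : {i // i ∈ A}, nu j < 0 ∧ s' = P.idx z \ {j.1} ∧ τ' = t) ∧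
            fderiv ℝ P.f z (P.h s' z) < 0) ∧
        (∀ y ∈ F, y.1 0 = z → ∃ t : ℝ, 0 ≤ t ∧ y.1 t ≠ z) ∧
        (∀ (c : ℝ) (s : Finset (Fin p)), (z, s) ∉ P.largestInvariant F (P.Omega c))) ∧
    (∀ A ∈ P.indexSets, ∀ z ∈ P.Gineq, P.h A z = 0 →
      ∀ (lam : Fin m → ℝ) (nu : {i // i ∈ A} → ℝ), P.IsMultiplier A z lam nu →
      (∀ k, 0 ≤ nu k) →
        P.KKT z ∧ P.h (P.idx z) z = 0 ∧
        (∀ (t τ : ℝ) (s' : Finset (Fin p)) (τ' : ℝ),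
          P.LawStep t z A τ s' τ' ↔ s' = P.idx z ∧ τ' = τ) ∧
        (∀ (t τ : ℝ) (s' : Finset (Fin p)) (τ' : ℝ),
          P.LawStep t z (P.idx z) τ s' τ' ↔ s' = P.idx z ∧ τ' = τ) ∧
        P.WeaklyInvariant F {(z, P.idx z)} ∧
        ((∃ K : NNReal, ∃ U ∈ 𝓝 z, LipschitzOnWith K (P.h (P.idx z)) U) →
          ∀ y ∈ F, y.1 0 = z → y.2 0 = P.idx z →
            ∀ t : ℝ, 0 ≤ t → y.1 t = z ∧ y.2 t = P.idx z)) := by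
  refine ⟨fun c x hx => hP.KKT_of_mem_largestInvariant hF₂ hx, ?_, ?_⟩
  · intro A hA z hz h0 lam nu hnu k hk
    obtain ⟨hgam, hAz, -⟩ := (hP.h_eq_zero_iff hA hz).1 h0
    obtain ⟨N, hN, hNnu⟩ := hnu.exists_isExtendedMultiplier
    have hidx := hN.mono hAz
    have hNk : N k < 0 := (hNnu k).trans_lt hk
    have hlaw {t τ : ℝ} (ht : τ + P.δT < t) {s' τ'} :=
      hN.lawStep_iff_of_neg hP hgam hAz (s' := s') (τ' := τ') ht hNk
    refine ⟨(hN.Jineq_dotProduct_h_sdiff_neg_iff hP hgam hAz k.2).2 hNk,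
      hN.fderiv_f_h_sdiff_neg hP hgam hAz hNk.ne,
      fun t τ ht => ⟨(hlaw ht).2 ⟨k, hNk, rfl, rfl⟩, fun s' τ' hstep => ?_⟩,
      fun y hy _ => hidx.exists_ne_of_neg hP hNk (hF₂ hy),
      fun c s => hidx.notMem_largestInvariant_of_neg hP hNk hF₂ s⟩
    obtain ⟨j, hj, rfl, rfl⟩ := (hlaw ht).1 hstep
    exact ⟨⟨⟨j, hN.mem_of_ne_zero hj.ne⟩, (hNnu _).symm.trans_lt hj, rfl, rfl⟩,
      hidx.fderiv_f_h_sdiff_neg hP hgam subset_rfl hj.ne⟩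
  · intro A hA z hz h0 lam nu hnu hnonneg
    obtain ⟨hgam, hAz, -⟩ := (hP.h_eq_zero_iff hA hz).1 h0
    obtain ⟨N, hN, hNnu⟩ := hnu.exists_isExtendedMultiplier
    have hidx := hN.mono hAz
    have hN0 := hN.nonneg_iff.2 fun i hi => (hnonneg ⟨i, hi⟩).trans_eq (hNnu ⟨i, hi⟩).symm
    refine ⟨hidx.KKT hgam hN0, hP.h_idx_eq_zero hA hz h0,
      fun _ _ _ _ => hN.lawStep_iff_of_nonneg hP hgam hAz hN0,
      fun _ _ _ _ => hidx.lawStep_iff_of_nonneg hP hgam subset_rfl hN0,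
      hidx.weaklyInvariant_singleton hP hgam hN0 hF₁, ?_⟩
    rintro ⟨K, U, hU, hLip⟩ y hy hy0 hσ0
    obtain ⟨T, hr, -, -⟩ := hF₂ hy
    exact hr.rest_of_lipschitzOnWith hP hgam hidx hN0 hU hLip hy0 hσ0

theorem proposition6 {n m p : ℕ} (P : SwitchedProblem n m p) (hP : P.Admissible)
    (F : Set ((ℝ → Fin n → ℝ) × (ℝ → Finset (Fin p))))
    (hF₁ : P.promptFamily ⊆ F) (hF₂ : F ⊆ P.delayedFamily) :
    -- points of the largest weakly invariant set inside `Ω` satisfy the KKT conditions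
    (∀ c : ℝ, ∀ x ∈ P.largestInvariant F (P.Omega c), P.KKT x.1) ∧
    -- subsystem equilibria with a negative multiplier
    (∀ A ∈ P.indexSets, ∀ z ∈ P.Gineq, P.h A z = 0 →
      ∀ (lam : Fin m → ℝ) (nu : {i // i ∈ A} → ℝ), P.IsMultiplier A z lam nu →
      ∀ k : {i // i ∈ A}, nu k < 0 →
        -- the `k`-th constraint and `f` strictly decrease along the subsystem without `k`
        P.Jineq z k ⬝ᵥ P.h (A \ {k.1}) z < 0 ∧
        fderiv ℝ P.f z (P.h (A \ {k.1}) z) < 0 ∧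
        -- the switching law removes an index with a negative multiplier, possibly `k`,
        -- as soon as the clock permits it, and then `f` strictly decreases
        (∀ t τ : ℝ, τ + P.δT < t →
          P.LawStep t z A τ (P.idx z \ {k.1}) t ∧
          ∀ s' τ', P.LawStep t z A τ s' τ' →
            (∃ j : {i // i ∈ A}, nu j < 0 ∧ s' = P.idx z \ {j.1} ∧ τ' = t) ∧
            fderiv ℝ P.f z (P.h s' z) < 0) ∧
        -- the point is not invariant
        (∀ y ∈ F, y.1 0 = z → ∃ t : ℝ, 0 ≤ t ∧ y.1 t ≠ z) ∧
        (∀ (c : ℝ) (s : Finset (Fin p)), (z, s) ∉ P.largestInvariant F (P.Omega c))) ∧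
    -- subsystem equilibria with nonnegative multipliers
    (∀ A ∈ P.indexSets, ∀ z ∈ P.Gineq, P.h A z = 0 →
      ∀ (lam : Fin m → ℝ) (nu : {i // i ∈ A} → ℝ), P.IsMultiplier A z lam nu →
      (∀ k, 0 ≤ nu k) →
        P.KKT z ∧ P.h (P.idx z) z = 0 ∧
        -- from `A` the law passes to the set of all active constraints, and there it stays
        (∀ (t τ : ℝ) (s' : Finset (Fin p)) (τ' : ℝ),
          P.LawStep t z A τ s' τ' ↔ s' = P.idx z ∧ τ' = τ) ∧
        (∀ (t τ : ℝ) (s' : Finset (Fin p)) (τ' : ℝ),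
          P.LawStep t z (P.idx z) τ s' τ' ↔ s' = P.idx z ∧ τ' = τ) ∧
        -- the point is invariant
        P.WeaklyInvariant F {(z, P.idx z)} ∧
        -- and if solutions are unique, every trajectory that starts there stays there
        ((∃ K : NNReal, ∃ U ∈ 𝓝 z, LipschitzOnWith K (P.h (P.idx z)) U) →
          ∀ y ∈ F, y.1 0 = z → y.2 0 = P.idx z →
            ∀ t : ℝ, 0 ≤ t → y.1 t = z ∧ y.2 t = P.idx z)) :=
  proposition6_general P hP.regular F hF₁ hF₂
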